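/- Let $\mathcal V=(\mathcal V,\otimes,I)$ be a small monoidal category and $\hat{\mathcal V}=[\mathcal V^{\mathrm{op}},\mathrm{SET}]$ with the Day convolution monoidal structure. **Conventions.** A right $\mathcal V$-graded category is a category $\mathcal B$ enriched in $\hat{\mathcal V}$ with composition morphisms $\mathcal B(A,B)\otimes\mathcal B(B,C)\to\mathcal B(A,C)$; equivalently, it has graded morphisms $f:A\cdot X\to B$ (the elements $f\in\mathcal B(A,B)(X)$, $X\in\mathcal V$), reindexing along morphisms of $\mathcal V$, composites $g\circ f:A\cdot X\otimes Y\to C$ for $f:A\cdot X\to B$ and $g:B\cdot Y\to C$, and identities $A\cdot I\to A$, subject to naturality, associativity and unit laws. Left $\mathcal V$-graded categories are right graded categories over the reverse monoidal category $\mathcal V^{\mathrm{rev}}$, and the formal opposite $\mathcal B^\circ$ of $\mathcal B$ is a left $\mathcal V$-graded category. A $\mathcal V$-$\mathcal V$-bigraded category is a left $(\mathcal V\times\mathcal V^{\mathrm{rev}})$-graded category; it has an underlying left $\mathcal V$-graded category (grades $(X,I)$) and an underlying right one (grades $(I,X')$). $\hat{\mathcal V}$ is $\mathcal V$-$\mathcal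 V$-bigraded: a graded morphism $P\to Q$ with grade $(X,Y)$ is a natural transformation $P\Rightarrow Q(X\otimes-\otimes Y)$. A bigraded square consists of graded morphisms $f:A\to A'$, $g:B\to B'$ with grade $(X,I)$ and $\varphi:A\to B$, $\varphi':A'\to B'$ with grade $(I,X')$ such that $g\circ\varphi$ and $\varphi'\circ f$ agree after reindexing along the unit isomorphisms to the grade $(X,X')$. The graded functor category $[\mathcal B^\circ,\hat{\mathcal V}]$ is the right $\mathcal V$-graded category whose objects are the left $\mathcal V$-graded functors $F:\mathcal B^\circ\to\hat{\mathcal V}$ and whose graded morphisms $\varphi:F\cdot X'\Rightarrow G$ are families $\varphi_A:FA\to GA$ of graded morphisms with grade $(I,X')$ that form bigraded squares with $Ff$ and $Gf$ for all graded morphisms $f$ of $\mathcal B^\circ$; composition is pointwise. A graded bifunctor $\mathcal A,\mathcal B\to\mathcal C$ ($\mathcal A$ left graded, $\mathcal B$ right graded, $\mathcal C$ bigraded) consists of left graded functors $F(-,B)$ and right graded functors $F(A,-)$ that agree on objects and satisfy the bigraded square condition; morphisms of graded bifunctors are families of morphisms of grade $(I,I)$ that are graded natural in each variable. For a right $\mathcal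 V$-graded category $\mathcal E$, the hom bifunctor $\mathcal E(-,?):\mathcal E^\circ,\mathcal E\to\hat{\mathcal V}$ acts by composition, $\mathcal E(f,B)(h)=h\circ f$ and $\mathcal E(A,g)(h)=g\circ h$. The evaluation bifunctor $\mathsf{Ev}:\mathcal B^\circ,[\mathcal B^\circ,\hat{\mathcal V}]\to\hat{\mathcal V}$ is $(B,F)\mapsto FB$. Street's presheaf $\hat{\mathcal V}$-category $\mathcal P\mathcal B$ has as objects the $\hat{\mathcal V}$-modules $F:\mathbb I\to\mathcal B$, i.e. families of objects $FA\in\hat{\mathcal V}$ with associative and unital actions $\mathcal B(A',A)\otimes FA\to FA'$; its hom-object $(\mathcal P\mathcal B)(F,G)$ is the right lifting of $G$ along $F$, i.e. the universal object $L$ of $\hat{\mathcal V}$ with a family $\varepsilon_A:FA\otimes L\to GA$ commuting with the actions, and composition and identities are induced by universality. Street's Yoneda embedding $\mathcal B\to\mathcal P\mathcal B$ sends $A$ to $\mathcal B(-,A)$ and is given on hom-objects by the transposes of the composition morphisms. **Statement.** Let $\mathcal B$ be a small right $\mathcal V$-graded category. 1. The assignment sending a module $F$ to the left graded functor $A\mapsto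 FA$, $(Ff)(x)=f\cdot x$, and sending $\varphi\in(\mathcal P\mathcal B)(F,G)(X)$ to the family of graded morphisms $x\mapsto\varepsilon_A(x,\varphi)$, is an isomorphism of right $\mathcal V$-graded categories $\mathcal P\mathcal B\cong[\mathcal B^\circ,\hat{\mathcal V}]$. 2. The composite of Street's Yoneda embedding with this isomorphism equals the right $\mathcal V$-graded functor $\mathsf y:\mathcal B\to[\mathcal B^\circ,\hat{\mathcal V}]$, $B\mapsto\mathcal B(-,B)$, that is the transpose of the hom bifunctor $\mathcal B(-,?):\mathcal B^\circ,\mathcal B\to\hat{\mathcal V}$; and $\mathsf y$ is fully faithful, i.e. bijective on graded morphisms of each grade. 3. There is an isomorphism of graded bifunctors $$[\mathcal B^\circ,\hat{\mathcal V}](\mathsf y-,?)\;\cong\;\mathsf{Ev}\;:\;\mathcal B^\circ,[\mathcal B^\circ,\hat{\mathcal V}]\to\hat{\mathcal V},$$ that is, $[\mathcal B^\circ,\hat{\mathcal V}](\mathcal B(-,B),F)\cong FB$, $\mathcal V$-graded naturally in $B\in\mathcal B$ and $F\in[\mathcal B^\circ,\hat{\mathcal V}]$, whose inverse sends $x\in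 FB(Z)$ to the graded morphism $\mathcal B(-,B)\cdot Z\Rightarrow F$ given by $f\mapsto (Ff)(x)\in FA(Y\otimes Z)$ for $f:A\cdot Y\to B$. -/

import Mathlib

open CategoryTheory MonoidalCategory Opposite
open scoped DayFunctor

universe u w w₁ w₂ w₃

namespace VGraded

/-- A (left) `V`-graded category: for objects `A`, `B` there is a presheaf `X ↦ Hom X A B` on `V`,
whose elements are the graded morphisms from `A` to `B` with grade `X`; for `f : Hom X A B` and
`g : Hom Y B C` there is a composite `g ∘ f : Hom (Y ⊗ X) A C`, and identities have grade `I`. -/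
structure GradedCat (V : Type u) [Category.{u} V] [MonoidalCategory V] where
  Obj : Type w
  Hom : V → Obj → Obj → Type u
  reindex : ∀ {X Y : V} {A B : Obj}, (Y ⟶ X) → Hom X A B → Hom Y A B
  comp : ∀ {X Y : V} {A B C : Obj}, Hom Y B C → Hom X A B → Hom (Y ⊗ X) A C
  id : ∀ A : Obj, Hom (𝟙_ V) A A
  reindex_id : ∀ {X : V} {A B : Obj} (f : Hom X A B), reindex (𝟙 X) f = f
  reindex_comp : ∀ {X Y Z : V} {A B : Obj} (a : Z ⟶ Y) (b : Y ⟶ X) (f : Hom X A B),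
    reindex (a ≫ b) f = reindex a (reindex b f)
  comp_reindex : ∀ {X X' Y Y' : V} {A B C : Obj} (b : Y' ⟶ Y) (a : X' ⟶ X)
    (g : Hom Y B C) (f : Hom X A B),
    comp (reindex b g) (reindex a f) = reindex (b ⊗ₘ a) (comp g f)
  assoc : ∀ {X Y Z : V} {A B C D : Obj} (h : Hom Z C D) (g : Hom Y B C) (f : Hom X A B),
    comp (comp h g) f = reindex (α_ Z Y X).hom (comp h (comp g f))
  comp_id : ∀ {X : V} {A B : Obj} (f : Hom X A B), comp f (id A) = reindex (ρ_ X).hom f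
  id_comp : ∀ {X : V} {A B : Obj} (f : Hom X A B), comp (id B) f = reindex (λ_ X).hom f

section Graded

variable {V : Type u} [Category.{u} V] [MonoidalCategory V]

/-- Composition in the underlying ordinary category `C₀`, whose morphisms are the graded
morphisms with grade the unit object. -/
def GradedCat.comp₀ (C : GradedCat.{u, w} V) {A B D : C.Obj} (g : C.Hom (𝟙_ V) B D)
    (f : C.Hom (𝟙_ V) A B) : C.Hom (𝟙_ V) A D :=
  C.reindex (λ_ (𝟙_ V)).inv (C.comp g f)

theorem GradedCat.comp_reindex_left (C : GradedCat.{u, w} V) {X Y Y' : V} {A B D : C.Obj}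
    (b : Y' ⟶ Y) (g : C.Hom Y B D) (f : C.Hom X A B) :
    C.comp (C.reindex b g) f = C.reindex (b ▷ X) (C.comp g f) := by
  have h := C.comp_reindex b (𝟙 X) g f
  rw [C.reindex_id, tensorHom_id] at h
  exact h

theorem GradedCat.comp_reindex_right (C : GradedCat.{u, w} V) {X X' Y : V} {A B D : C.Obj}
    (a : X' ⟶ X) (g : C.Hom Y B D) (f : C.Hom X A B) :
    C.comp g (C.reindex a f) = C.reindex (Y ◁ a) (C.comp g f) := by
  have h := C.comp_reindex (𝟙 Y) a g f
  rw [C.reindex_id, id_tensorHom] at h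
  exact h

theorem GradedCat.assoc' (C : GradedCat.{u, w} V) {X Y Z : V} {A B D E : C.Obj}
    (h : C.Hom Z D E) (g : C.Hom Y B D) (f : C.Hom X A B) :
    C.comp h (C.comp g f) = C.reindex (α_ Z Y X).inv (C.comp (C.comp h g) f) := by
  rw [C.assoc, ← C.reindex_comp, Iso.inv_hom_id, C.reindex_id]

/-- A (left) `V`-graded functor. -/
@[ext]
structure GradedFunctor (C : GradedCat.{u, w₁} V) (D : GradedCat.{u, w₂} V) where
  obj : C.Obj → D.Obj
  map : ∀ {X : V} {A B : C.Obj}, C.Hom X A B → D.Hom X (obj A) (obj B)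
  map_reindex : ∀ {X Y : V} {A B : C.Obj} (a : Y ⟶ X) (f : C.Hom X A B),
    map (C.reindex a f) = D.reindex a (map f)
  map_comp : ∀ {X Y : V} {A B E : C.Obj} (g : C.Hom Y B E) (f : C.Hom X A B),
    map (C.comp g f) = D.comp (map g) (map f)
  map_id : ∀ A : C.Obj, map (C.id A) = D.id (obj A)

/-- The identity graded functor. -/
def GradedFunctor.refl (C : GradedCat.{u, w} V) : GradedFunctor C C where
  obj A := A
  map f := f
  map_reindex _ _ := rfl
  map_comp _ _ := rfl
  map_id _ := rfl

/-- The composite `G ∘ F`. -/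
def GradedFunctor.comp {C : GradedCat.{u, w₁} V} {D : GradedCat.{u, w₂} V}
    {E : GradedCat.{u, w₃} V} (G : GradedFunctor D E) (F : GradedFunctor C D) :
    GradedFunctor C E where
  obj A := G.obj (F.obj A)
  map f := G.map (F.map f)
  map_reindex a f := by rw [F.map_reindex, G.map_reindex]
  map_comp g f := by rw [F.map_comp, G.map_comp]
  map_id A := by rw [F.map_id, G.map_id]

/-- `F` is an isomorphism of graded categories. -/
def GradedFunctor.IsIso {C : GradedCat.{u, w₁} V} {D : GradedCat.{u, w₂} V}
    (F : GradedFunctor C D) : Prop :=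
  ∃ G : GradedFunctor D C, G.comp F = GradedFunctor.refl C ∧ F.comp G = GradedFunctor.refl D

/-- `F` is fully faithful: it is bijective on graded morphisms of every grade. -/
def GradedFunctor.FullyFaithful {C : GradedCat.{u, w₁} V} {D : GradedCat.{u, w₂} V}
    (F : GradedFunctor C D) : Prop :=
  ∀ (X : V) (A B : C.Obj),
    Function.Bijective (F.map : C.Hom X A B → D.Hom X (F.obj A) (F.obj B))

/-- A family of morphisms `δ A : F A ⟶ G A` of the underlying ordinary category of `D` is
`V`-graded natural at the graded morphism `f`. -/
def GradedFunctor.NaturalAt {C : GradedCat.{u, w₁} V} {D : GradedCat.{u, w₂} V}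
    (F G : GradedFunctor C D) {X : V} {A B : C.Obj} (f : C.Hom X A B)
    (δA : D.Hom (𝟙_ V) (F.obj A) (G.obj A)) (δB : D.Hom (𝟙_ V) (F.obj B) (G.obj B)) : Prop :=
  D.reindex (λ_ X).inv (D.comp δB (F.map f)) = D.reindex (ρ_ X).inv (D.comp (G.map f) δA)

/-- Contravariant change of base along an opmonoidal functor `K`. -/
def GradedCat.changeBase {W : Type u} [Category.{u} W] [MonoidalCategory W]
    (K : V ⥤ W) [K.OplaxMonoidal] (C : GradedCat.{u, w} W) : GradedCat.{u, w} V where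
  Obj := C.Obj
  Hom X A B := C.Hom (K.obj X) A B
  reindex a f := C.reindex (K.map a) f
  comp {X Y _ _ _} g f := C.reindex (Functor.OplaxMonoidal.δ K Y X) (C.comp g f)
  id A := C.reindex (Functor.OplaxMonoidal.η K) (C.id A)
  reindex_id f := by rw [K.map_id, C.reindex_id]
  reindex_comp a b f := by rw [K.map_comp, C.reindex_comp]
  comp_reindex b a g f := by
    rw [C.comp_reindex, ← C.reindex_comp, ← C.reindex_comp, Functor.OplaxMonoidal.δ_natural]
  assoc h g f := by
    rw [C.comp_reindex_left, C.comp_reindex_right, C.assoc]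
    simp only [← C.reindex_comp]
    congr 1
    simp
  comp_id f := by
    rw [C.comp_reindex_right, C.comp_id]
    simp only [← C.reindex_comp]
    congr 1
    simp
  id_comp f := by
    rw [C.comp_reindex_left, C.id_comp]
    simp only [← C.reindex_comp]
    congr 1
    simp

/-- Right `V`-graded categories are left graded categories over the reverse of `V`: the composite of
`f` with grade `X` and `g` with grade `Y` has grade `X ⊗ Y`. -/
abbrev RightGradedCat (V : Type u) [Category.{u} V] [MonoidalCategory V] :=
  GradedCat.{u, w} Vᴹᵒᵖ

/-- The formal opposite `C°` (a left `V`-graded category) of a right `V`-graded category `C`. -/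
def formalOp (C : RightGradedCat.{u, w} V) : GradedCat.{u, w} V where
  Obj := C.Obj
  Hom X A B := C.Hom (.mop X) B A
  reindex a f := C.reindex a.mop f
  comp g f := C.comp f g
  id A := C.id A
  reindex_id f := C.reindex_id f
  reindex_comp a b f := C.reindex_comp a.mop b.mop f
  comp_reindex b a g f := C.comp_reindex a.mop b.mop f g
  assoc h g f := C.assoc' f g h
  comp_id f := C.id_comp f
  id_comp f := C.comp_id f

/-- The left graded functor `F° : C° ⟶ D°` of a right graded functor `F : C ⟶ D`. -/
def GradedFunctor.formalOp {C : RightGradedCat.{u, w₁} V} {D : RightGradedCat.{u, w₂} V}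
    (F : GradedFunctor C D) : GradedFunctor (VGraded.formalOp C) (VGraded.formalOp D) where
  obj := F.obj
  map f := F.map f
  map_reindex a f := F.map_reindex a.mop f
  map_comp g f := F.map_comp f g
  map_id A := F.map_id A

end Graded

section Bigraded

variable {V W : Type u} [Category.{u} V] [MonoidalCategory V] [Category.{u} W]
  [MonoidalCategory W]

/-- A `V`-`W`-bigraded category is a (left) `V × W^rev`-graded category. -/
abbrev BigradedCat (V W : Type u) [Category.{u} V] [MonoidalCategory V] [Category.{u} W]
    [MonoidalCategory W] := GradedCat.{u, w} (V × Wᴹᵒᵖ)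

/-- The functor `(-, I) : V ⥤ V × W`. -/
def leftIncl (V W : Type u) [Category.{u} V] [MonoidalCategory V] [Category.{u} W]
    [MonoidalCategory W] : V ⥤ V × W where
  obj X := (X, 𝟙_ W)
  map a := Prod.mkHom a (𝟙 _)

/-- The functor `(I, -) : W ⥤ V × W`. -/
def rightIncl (V W : Type u) [Category.{u} V] [MonoidalCategory V] [Category.{u} W]
    [MonoidalCategory W] : W ⥤ V × W where
  obj X := (𝟙_ V, X)
  map a := Prod.mkHom (𝟙 _) a

instance : (leftIncl V W).OplaxMonoidal where
  η := 𝟙 _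
  δ X Y := Prod.mkHom (𝟙 (X ⊗ Y)) (λ_ (𝟙_ W)).inv
  δ_natural_left f X' := by ext <;> simp [leftIncl]
  δ_natural_right X' f := by ext <;> simp [leftIncl]
  oplax_associativity X Y Z := by
    ext
    · simp [leftIncl]
    · simp [leftIncl]
      monoidal
  oplax_left_unitality X := by ext <;> simp [leftIncl]
  oplax_right_unitality X := by
    ext
    · simp [leftIncl]
    · simp [leftIncl, unitors_inv_equal]

instance : (rightIncl V W).OplaxMonoidal where
  η := 𝟙 _
  δ X Y := Prod.mkHom (λ_ (𝟙_ V)).inv (𝟙 (X ⊗ Y))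
  δ_natural_left f X' := by ext <;> simp [rightIncl]
  δ_natural_right X' f := by ext <;> simp [rightIncl]
  oplax_associativity X Y Z := by
    ext
    · simp [rightIncl]
      monoidal
    · simp [rightIncl]
  oplax_left_unitality X := by ext <;> simp [rightIncl]
  oplax_right_unitality X := by
    ext
    · simp [rightIncl, unitors_inv_equal]
    · simp [rightIncl]

/-- The left `V`-graded category underlying a `V`-`W`-bigraded category. -/
abbrev leftPart (C : BigradedCat.{u, w} V W) : GradedCat.{u, w} V :=
  C.changeBase (leftIncl V Wᴹᵒᵖ)

/-- The right `W`-graded category underlying a `V`-`W`-bigraded category. -/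
abbrev rightPart (C : BigradedCat.{u, w} V W) : RightGradedCat.{u, w} W :=
  C.changeBase (rightIncl V Wᴹᵒᵖ)

/-- Bigraded squares in a `V`-`W`-bigraded category. Note that the left and right unitors of
`W` are the right and left unitors of its reverse, respectively. -/
def IsBigradedSquare (C : BigradedCat.{u, w} V W) {X : V} {X' : Wᴹᵒᵖ} {A A' B B' : C.Obj}
    (f : C.Hom (X, 𝟙_ Wᴹᵒᵖ) A A') (g : C.Hom (X, 𝟙_ Wᴹᵒᵖ) B B')
    (φ : C.Hom (𝟙_ V, X') A B) (φ' : C.Hom (𝟙_ V, X') A' B') : Prop :=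
  C.reindex (X := (X, 𝟙_ Wᴹᵒᵖ) ⊗ (𝟙_ V, X')) (Y := (X, X'))
      (Prod.mkHom (ρ_ X).inv (λ_ X').inv) (C.comp g φ) =
    C.reindex (X := (𝟙_ V, X') ⊗ (X, 𝟙_ Wᴹᵒᵖ)) (Y := (X, X'))
      (Prod.mkHom (λ_ X).inv (ρ_ X').inv) (C.comp φ' f)

theorem isBigradedSquare_iff (C : BigradedCat.{u, w} V W) {X : V} {X' : Wᴹᵒᵖ}
    {A A' B B' : C.Obj}
    (f : C.Hom (X, 𝟙_ Wᴹᵒᵖ) A A') (g : C.Hom (X, 𝟙_ Wᴹᵒᵖ) B B')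
    (φ : C.Hom (𝟙_ V, X') A B) (φ' : C.Hom (𝟙_ V, X') A' B') :
    IsBigradedSquare C f g φ φ' ↔
      C.comp g φ =
        C.reindex (X := (𝟙_ V, X') ⊗ (X, 𝟙_ Wᴹᵒᵖ)) (Y := (X, 𝟙_ Wᴹᵒᵖ) ⊗ (𝟙_ V, X'))
          (Prod.mkHom ((ρ_ X).hom ≫ (λ_ X).inv) ((λ_ X').hom ≫ (ρ_ X').inv))
          (C.comp φ' f) := by
  unfold IsBigradedSquare
  constructor
  · intro h
    have h2 := congrArg (C.reindex (X := (X, X')) (Y := (X, 𝟙_ Wᴹᵒᵖ) ⊗ (𝟙_ V, X'))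
      (Prod.mkHom (ρ_ X).hom (λ_ X').hom)) h
    simp only [← C.reindex_comp] at h2
    refine Eq.trans ?_ (h2.trans ?_)
    · refine (C.reindex_id _).symm.trans ?_
      congr 1
      ext <;> simp
    · congr 1
  · intro h
    rw [h, ← C.reindex_comp]
    congr 1
    ext <;> simp

theorem IsBigradedSquare.comp {C : BigradedCat.{u, w} V W} {X : V} {X' Y' : Wᴹᵒᵖ}
    {A A' B B' D D' : C.Obj} {f : C.Hom (X, 𝟙_ Wᴹᵒᵖ) A A'} {g : C.Hom (X, 𝟙_ Wᴹᵒᵖ) B B'}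
    {h : C.Hom (X, 𝟙_ Wᴹᵒᵖ) D D'} {φ : C.Hom (𝟙_ V, X') A B}
    {φ' : C.Hom (𝟙_ V, X') A' B'} {ψ : C.Hom (𝟙_ V, Y') B D}
    {ψ' : C.Hom (𝟙_ V, Y') B' D'} (s : IsBigradedSquare C f g φ φ')
    (t : IsBigradedSquare C g h ψ ψ') :
    IsBigradedSquare C (X' := Y' ⊗ X') f h
      (C.reindex (X := (𝟙_ V, Y') ⊗ (𝟙_ V, X')) (Y := (𝟙_ V, Y' ⊗ X'))
        (Prod.mkHom (λ_ (𝟙_ V)).inv (𝟙 (Y' ⊗ X'))) (C.comp ψ φ))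
      (C.reindex (X := (𝟙_ V, Y') ⊗ (𝟙_ V, X')) (Y := (𝟙_ V, Y' ⊗ X'))
        (Prod.mkHom (λ_ (𝟙_ V)).inv (𝟙 (Y' ⊗ X'))) (C.comp ψ' φ')) := by
  rw [isBigradedSquare_iff] at s t ⊢
  rw [C.comp_reindex_right, C.comp_reindex_left, C.assoc' h, t, C.comp_reindex_left,
    C.assoc ψ', s, C.comp_reindex_right, C.assoc' ψ']
  simp only [← C.reindex_comp]
  congr 1
  ext <;> simp

theorem IsBigradedSquare.reindex {C : BigradedCat.{u, w} V W} {X : V} {X' Y' : Wᴹᵒᵖ}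
    {A A' B B' : C.Obj} {f : C.Hom (X, 𝟙_ Wᴹᵒᵖ) A A'} {g : C.Hom (X, 𝟙_ Wᴹᵒᵖ) B B'}
    {φ : C.Hom (𝟙_ V, X') A B} {φ' : C.Hom (𝟙_ V, X') A' B'} (b : Y' ⟶ X')
    (s : IsBigradedSquare C f g φ φ') :
    IsBigradedSquare C (X' := Y') f g
      (C.reindex (X := (𝟙_ V, X')) (Y := (𝟙_ V, Y')) (Prod.mkHom (𝟙 (𝟙_ V)) b) φ)
      (C.reindex (X := (𝟙_ V, X')) (Y := (𝟙_ V, Y')) (Prod.mkHom (𝟙 (𝟙_ V)) b) φ') := by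
  rw [isBigradedSquare_iff] at s ⊢
  rw [C.comp_reindex_right, C.comp_reindex_left, s]
  simp only [← C.reindex_comp]
  congr 1
  ext <;> simp

theorem IsBigradedSquare.id {C : BigradedCat.{u, w} V W} {X : V} {A A' : C.Obj}
    (f : C.Hom (X, 𝟙_ Wᴹᵒᵖ) A A') :
    IsBigradedSquare C (X' := 𝟙_ Wᴹᵒᵖ) f f
      (C.reindex (X := 𝟙_ (V × Wᴹᵒᵖ)) (Y := (𝟙_ V, 𝟙_ Wᴹᵒᵖ)) (𝟙 (𝟙_ (V × Wᴹᵒᵖ))) (C.id A))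
      (C.reindex (X := 𝟙_ (V × Wᴹᵒᵖ)) (Y := (𝟙_ V, 𝟙_ Wᴹᵒᵖ)) (𝟙 (𝟙_ (V × Wᴹᵒᵖ))) (C.id A')) := by
  rw [isBigradedSquare_iff]
  refine (C.comp_reindex_right _ f (C.id A)).trans ?_
  refine Eq.trans ?_ (congrArg _ (C.comp_reindex_left _ (C.id A') f).symm)
  rw [C.comp_id, C.id_comp]
  refine (C.reindex_comp _ _ _).symm.trans (Eq.trans ?_ (congrArg _ (C.reindex_comp _ _ _)))
  refine Eq.trans ?_ (C.reindex_comp _ _ _)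
  congr 1
  ext <;> simp [unitors_equal]

/-- The graded functor category `[A, C]`: a right `W`-graded category whose objects are the left
`V`-graded functors from `A` to (the left `V`-graded category underlying) `C`. -/
def functorCat (A : GradedCat.{u, u} V) (C : BigradedCat.{u, w} V W) :
    RightGradedCat.{u, max u w} W where
  Obj := GradedFunctor A (leftPart C)
  Hom X' F G := { φ : ∀ a : A.Obj, (rightPart C).Hom X' (F.obj a) (G.obj a) //
    ∀ {X : V} {a b : A.Obj} (f : A.Hom X a b),
      IsBigradedSquare C (F.map f) (G.map f) (φ a) (φ b) }
  reindex b φ := ⟨fun a => (rightPart C).reindex b (φ.1 a), fun f => (φ.2 f).reindex b⟩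
  comp ψ φ := ⟨fun a => (rightPart C).comp (ψ.1 a) (φ.1 a), fun f => (φ.2 f).comp (ψ.2 f)⟩
  id F := ⟨fun a => (rightPart C).id (F.obj a), fun f => IsBigradedSquare.id (F.map f)⟩
  reindex_id _ := Subtype.ext (funext fun _ => (rightPart C).reindex_id _)
  reindex_comp _ _ _ := Subtype.ext (funext fun _ => (rightPart C).reindex_comp _ _ _)
  comp_reindex _ _ _ _ := Subtype.ext (funext fun _ => (rightPart C).comp_reindex _ _ _ _)
  assoc _ _ _ := Subtype.ext (funext fun _ => (rightPart C).assoc _ _ _)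
  comp_id _ := Subtype.ext (funext fun _ => (rightPart C).comp_id _)
  id_comp _ := Subtype.ext (funext fun _ => (rightPart C).id_comp _)

/-- Graded bifunctors `A, B ⟶ C`: left graded functors `F(-, b)` and right graded functors
`F(a, -)` that agree on objects and satisfy the bigraded square condition. -/
@[ext]
structure GradedBifunctor (A : GradedCat.{u, w₁} V) (B : RightGradedCat.{u, w₂} W)
    (C : BigradedCat.{u, w₃} V W) where
  obj : A.Obj → B.Obj → C.Obj
  mapLeft : ∀ {X : V} {a a' : A.Obj} (_ : A.Hom X a a') (b : B.Obj),
    (leftPart C).Hom X (obj a b) (obj a' b)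
  mapRight : ∀ {X' : Wᴹᵒᵖ} (a : A.Obj) {b b' : B.Obj} (_ : B.Hom X' b b'),
    (rightPart C).Hom X' (obj a b) (obj a b')
  mapLeft_reindex : ∀ {X Y : V} {a a' : A.Obj} (s : Y ⟶ X) (f : A.Hom X a a') (b : B.Obj),
    mapLeft (A.reindex s f) b = (leftPart C).reindex s (mapLeft f b)
  mapLeft_comp : ∀ {X Y : V} {a a' a'' : A.Obj} (g : A.Hom Y a' a'') (f : A.Hom X a a')
    (b : B.Obj), mapLeft (A.comp g f) b = (leftPart C).comp (mapLeft g b) (mapLeft f b)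
  mapLeft_id : ∀ (a : A.Obj) (b : B.Obj), mapLeft (A.id a) b = (leftPart C).id (obj a b)
  mapRight_reindex : ∀ {X' Y' : Wᴹᵒᵖ} (a : A.Obj) {b b' : B.Obj} (s : Y' ⟶ X')
    (f : B.Hom X' b b'), mapRight a (B.reindex s f) = (rightPart C).reindex s (mapRight a f)
  mapRight_comp : ∀ {X' Y' : Wᴹᵒᵖ} (a : A.Obj) {b b' b'' : B.Obj} (g : B.Hom Y' b' b'')
    (f : B.Hom X' b b'), mapRight a (B.comp g f) =
      (rightPart C).comp (mapRight a g) (mapRight a f)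
  mapRight_id : ∀ (a : A.Obj) (b : B.Obj), mapRight a (B.id b) = (rightPart C).id (obj a b)
  square : ∀ {X : V} {X' : Wᴹᵒᵖ} {a a' : A.Obj} {b b' : B.Obj} (f : A.Hom X a a')
    (g : B.Hom X' b b'),
    IsBigradedSquare C (mapLeft f b) (mapLeft f b') (mapRight a g) (mapRight a' g)

namespace GradedBifunctor

variable {A : GradedCat.{u, w₁} V} {B : RightGradedCat.{u, w₂} W} {C : BigradedCat.{u, w₃} V W}

/-- The left graded functor `F(-, b)`. -/
def leftFunctor (F : GradedBifunctor A B C) (b : B.Obj) : GradedFunctor A (leftPart C) where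
  obj a := F.obj a b
  map f := F.mapLeft f b
  map_reindex s f := F.mapLeft_reindex s f b
  map_comp g f := F.mapLeft_comp g f b
  map_id a := F.mapLeft_id a b

/-- The right graded functor `F(a, -)`. -/
def rightFunctor (F : GradedBifunctor A B C) (a : A.Obj) : GradedFunctor B (rightPart C) where
  obj b := F.obj a b
  map f := F.mapRight a f
  map_reindex s f := F.mapRight_reindex a s f
  map_comp g f := F.mapRight_comp a g f
  map_id b := F.mapRight_id a b

/-- The graded bifunctor `F(H -, ?)`. -/
def precompLeft {A' : GradedCat.{u, w} V} (F : GradedBifunctor A B C) (H : GradedFunctor A' A) :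
    GradedBifunctor A' B C where
  obj a b := F.obj (H.obj a) b
  mapLeft f b := F.mapLeft (H.map f) b
  mapRight a _ _ f := F.mapRight (H.obj a) f
  mapLeft_reindex s f b := by rw [H.map_reindex, F.mapLeft_reindex]
  mapLeft_comp g f b := by rw [H.map_comp, F.mapLeft_comp]
  mapLeft_id a b := by rw [H.map_id, F.mapLeft_id]
  mapRight_reindex a _ _ s f := F.mapRight_reindex (H.obj a) s f
  mapRight_comp a _ _ _ g f := F.mapRight_comp (H.obj a) g f
  mapRight_id a b := F.mapRight_id (H.obj a) b
  square f g := F.square (H.map f) g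

/-- A transformation of graded bifunctors: a family of morphisms of the underlying ordinary
category of `C` that is graded natural in each variable. -/
structure Transformation (F G : GradedBifunctor A B C) where
  app : ∀ (a : A.Obj) (b : B.Obj), C.Hom (𝟙_ (V × Wᴹᵒᵖ)) (F.obj a b) (G.obj a b)
  natural_left : ∀ (b : B.Obj) {X : V} {a a' : A.Obj} (f : A.Hom X a a'),
    GradedFunctor.NaturalAt (F.leftFunctor b) (G.leftFunctor b) f (app a b) (app a' b)
  natural_right : ∀ (a : A.Obj) {X' : Wᴹᵒᵖ} {b b' : B.Obj} (g : B.Hom X' b b'),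
    GradedFunctor.NaturalAt (F.rightFunctor a) (G.rightFunctor a) g (app a b) (app a b')

/-- `θ` and `η` are mutually inverse transformations of graded bifunctors. -/
def Transformation.IsInversePair {F G : GradedBifunctor A B C} (θ : Transformation F G)
    (η : Transformation G F) : Prop :=
  ∀ (a : A.Obj) (b : B.Obj), C.comp₀ (η.app a b) (θ.app a b) = C.id (F.obj a b) ∧
    C.comp₀ (θ.app a b) (η.app a b) = C.id (G.obj a b)

/-- The transpose `B ⟶ [A, C]`, `b ↦ F(-, b)`, of a graded bifunctor `F : A, B ⟶ C`. -/
def transpose {A : GradedCat.{u, u} V} (F : GradedBifunctor A B C) :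
    GradedFunctor B (functorCat A C) where
  obj b := F.leftFunctor b
  map g := ⟨fun a => F.mapRight a g, fun f => F.square f g⟩
  map_reindex s g := Subtype.ext (funext fun a => F.mapRight_reindex a s g)
  map_comp g f := Subtype.ext (funext fun a => F.mapRight_comp a g f)
  map_id b := Subtype.ext (funext fun a => F.mapRight_id a b)

end GradedBifunctor

/-- The evaluation bifunctor `Ev : A, [A, C] ⟶ C`. -/
def evaluation (A : GradedCat.{u, u} V) (C : BigradedCat.{u, w} V W) :
    GradedBifunctor A (functorCat A C) C where
  obj a F := F.obj a
  mapLeft f F := F.map f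
  mapRight a _ _ φ := φ.1 a
  mapLeft_reindex s f F := F.map_reindex s f
  mapLeft_comp g f F := F.map_comp g f
  mapLeft_id a F := F.map_id a
  mapRight_reindex _ _ _ _ _ := rfl
  mapRight_comp _ _ _ _ _ _ := rfl
  mapRight_id _ _ := rfl
  square f φ := φ.2 f

end Bigraded

section Presheaves

variable (V : Type u) [Category.{u} V] [MonoidalCategory V]

/-- The category `V̂` of presheaves on `V`, equipped with Day convolution. -/
abbrev Hat := Vᵒᵖ ⊛⥤ Type u

variable {V}


/-- The action `P X ⟶ P Y` of a morphism `c : Y ⟶ X` on a presheaf `P`. -/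
def Hat.res (P : Hat V) {X Y : V} (c : Y ⟶ X) (x : P.functor.obj (op X)) :
    P.functor.obj (op Y) :=
  P.functor.map c.op x

@[simp]
theorem Hat.res_id (P : Hat V) {X : V} (x : P.functor.obj (op X)) : P.res (𝟙 X) x = x := by
  simp [Hat.res]

theorem Hat.res_res (P : Hat V) {X Y Z : V} (a : Z ⟶ Y) (b : Y ⟶ X)
    (x : P.functor.obj (op X)) : P.res a (P.res b x) = P.res (a ≫ b) x := by
  simp [Hat.res]

/-- A graded morphism `φ : P ⟶ Q` in `V̂` with grade `(X, Y)`: a natural family of maps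
`P Z → Q (X ⊗ Z ⊗ Y)`. -/
@[ext]
structure HatHom (X Y : V) (P Q : Hat V) where
  app : ∀ Z : V, P.functor.obj (op Z) → Q.functor.obj (op ((X ⊗ Z) ⊗ Y))
  naturality : ∀ {Z Z' : V} (c : Z' ⟶ Z) (p : P.functor.obj (op Z)),
    app Z' (P.res c p) = Q.res ((X ◁ c) ▷ Y) (app Z p)

/-- The coherence isomorphism
`((Y ⊗ X) ⊗ Z) ⊗ (X' ⊗ Y') ⟶ (Y ⊗ ((X ⊗ Z) ⊗ X')) ⊗ Y'`. -/
def sandwichComp (X X' Y Y' Z : V) :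
    ((Y ⊗ X) ⊗ Z) ⊗ (X' ⊗ Y') ⟶ (Y ⊗ ((X ⊗ Z) ⊗ X')) ⊗ Y' :=
  (α_ ((Y ⊗ X) ⊗ Z) X' Y').inv ≫ ((α_ Y X Z).hom ▷ X' ≫ (α_ Y (X ⊗ Z) X').hom) ▷ Y'

theorem sandwichComp_natural {X₁ X₁' Y₁ Y₁' X₂ X₂' Y₂ Y₂' : V} (a : X₁ ⟶ X₂) (a' : X₁' ⟶ X₂')
    (b : Y₁ ⟶ Y₂) (b' : Y₁' ⟶ Y₂') (Z : V) :
    ((b ⊗ₘ a) ▷ Z ⊗ₘ (a' ⊗ₘ b')) ≫ sandwichComp X₂ X₂' Y₂ Y₂' Z =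
      sandwichComp X₁ X₁' Y₁ Y₁' Z ≫ ((b ⊗ₘ (a ▷ Z ⊗ₘ a')) ⊗ₘ b') := by
  simp only [sandwichComp, ← tensorHom_id, associator_inv_naturality_assoc,
    tensorHom_comp_tensorHom, tensorHom_comp_tensorHom_assoc, associator_naturality,
    Category.assoc, Category.comp_id, Category.id_comp]
  rw [← associator_naturality b (a ⊗ₘ 𝟙 Z) a', tensorHom_comp_tensorHom_assoc, Category.id_comp]

/-- `V̂` as a `V`-`V`-bigraded category. -/
def hatBigraded (V : Type u) [Category.{u} V] [MonoidalCategory V] :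
    BigradedCat.{u, u + 1} V V where
  Obj := Hat V
  Hom X P Q := HatHom X.1 X.2.unmop P Q
  reindex {X Y _ Q} s φ :=
    { app Z p := Q.res ((s.1 ▷ Z) ⊗ₘ s.2.unmop) (φ.app Z p)
      naturality c p := by
        rw [φ.naturality, Q.res_res, Q.res_res]
        congr 1
        simp only [← tensorHom_id, ← id_tensorHom, tensorHom_comp_tensorHom, Category.comp_id,
          Category.id_comp] }
  comp {X Y _ _ R} ψ φ :=
    { app Z p := R.res (sandwichComp X.1 X.2.unmop Y.1 Y.2.unmop Z)
        (ψ.app ((X.1 ⊗ Z) ⊗ X.2.unmop) (φ.app Z p))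
      naturality c p := by
        rw [φ.naturality, ψ.naturality, R.res_res]
        refine Eq.trans ?_ (R.res_res _ _ _).symm
        congr 1
        simp [sandwichComp]
        monoidal }
  id P :=
    { app Z p := P.res ((ρ_ (𝟙_ V ⊗ Z)).hom ≫ (λ_ Z).hom) p
      naturality c p := by
        refine (P.res_res _ _ _).trans (Eq.trans ?_ (P.res_res _ _ _).symm)
        congr 1
        simp }
  reindex_id f := by
    ext Z p
    simp
  reindex_comp a b f := by
    ext Z p
    refine Eq.trans ?_ (Hat.res_res _ _ _ _).symm
    dsimp only
    congr 1
    simp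
  comp_reindex b a g f := by
    ext Z p
    dsimp only
    rw [g.naturality, Hat.res_res]
    refine (Hat.res_res _ _ _ _).trans (Eq.trans ?_ (Hat.res_res _ _ _ _).symm)
    congr 1
    refine Eq.trans ?_ (sandwichComp_natural a.1 a.2.unmop b.1 b.2.unmop Z).symm
    simp only [← tensorHom_id, ← id_tensorHom, tensorHom_comp_tensorHom, Category.assoc,
      Category.comp_id, Category.id_comp]
  assoc h g f := by
    ext Z p
    dsimp only
    rw [h.naturality]
    refine (Hat.res_res _ _ _ _).trans (Eq.trans ?_ (congrArg _ (Hat.res_res _ _ _ _).symm))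
    refine Eq.trans ?_ (Hat.res_res _ _ _ _).symm
    congr 1
    simp [sandwichComp]
    monoidal
  comp_id {X _ _} f := by
    ext Z p
    dsimp only
    rw [f.naturality]
    refine (Hat.res_res _ _ _ _).trans ?_
    refine congrFun (congrArg _ ?_) _
    obtain ⟨X, X'⟩ := X
    change sandwichComp (𝟙_ V) (𝟙_ V) X X'.unmop Z ≫
      ((X ◁ ((ρ_ (𝟙_ V ⊗ Z)).hom ≫ (λ_ Z).hom)) ▷ X'.unmop) =
        ((ρ_ X).hom ▷ Z) ⊗ₘ (λ_ X'.unmop).hom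
    unfold sandwichComp
    monoidal
  id_comp {X _ _} f := by
    ext Z p
    refine (Hat.res_res _ _ _ _).trans ?_
    refine congrFun (congrArg _ ?_) _
    obtain ⟨X, X'⟩ := X
    change sandwichComp X X'.unmop (𝟙_ V) (𝟙_ V) Z ≫
      ((ρ_ (𝟙_ V ⊗ ((X ⊗ Z) ⊗ X'.unmop))).hom ≫ (λ_ ((X ⊗ Z) ⊗ X'.unmop)).hom) =
        ((λ_ X).hom ▷ Z) ⊗ₘ (ρ_ X'.unmop).hom
    unfold sandwichComp
    monoidal

theorem Hat.res_congr (P : Hat V) {X Y : V} {a b : Y ⟶ X} (h : a = b)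
    (x : P.functor.obj (op X)) : P.res a x = P.res b x := by
  rw [h]

theorem Hat.res_bijective (P : Hat V) {X Y : V} (a : Y ⟶ X) (b : X ⟶ Y) (hab : a ≫ b = 𝟙 Y)
    (hba : b ≫ a = 𝟙 X) : Function.Bijective (P.res a) := by
  refine Function.bijective_iff_has_inverse.2 ⟨P.res b, fun x => ?_, fun x => ?_⟩
  · rw [P.res_res, hba, P.res_id]
  · rw [P.res_res, hab, P.res_id]

/-- A graded morphism in `V̂` with grade `(X, I)`, as a family of maps `P Z → Q (X ⊗ Z)`. -/
def leftApply {X : V} {P Q : Hat V} (φ : (leftPart (hatBigraded V)).Hom X P Q) {Z : V}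
    (p : P.functor.obj (op Z)) : Q.functor.obj (op (X ⊗ Z)) :=
  Q.res (ρ_ (X ⊗ Z)).inv (HatHom.app φ Z p)

/-- A graded morphism in `V̂` with grade `(I, X')`, as a family of maps `P Z → Q (Z ⊗ X')`. -/
def rightApply {X' : Vᴹᵒᵖ} {P Q : Hat V} (φ : (rightPart (hatBigraded V)).Hom X' P Q) {Z : V}
    (p : P.functor.obj (op Z)) : Q.functor.obj (op (Z ⊗ X'.unmop)) :=
  Q.res ((λ_ Z).inv ▷ X'.unmop) (HatHom.app φ Z p)

/-- A graded morphism in `V̂` with grade `(I, I)`, as a family of maps `P Z → Q Z`. -/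
def unitApply {P Q : Hat V} (φ : (hatBigraded V).Hom (𝟙_ (V × Vᴹᵒᵖ)) P Q) {Z : V}
    (p : P.functor.obj (op Z)) : Q.functor.obj (op Z) :=
  Q.res ((λ_ Z).inv ≫ (ρ_ (𝟙_ V ⊗ Z)).inv) (HatHom.app φ Z p)

/-- The graded morphism with grade `(X, I)` given by a natural family `P Z → Q (X ⊗ Z)`. -/
def ofLeft {X : V} {P Q : Hat V}
    (m : ∀ Z : V, P.functor.obj (op Z) → Q.functor.obj (op (X ⊗ Z)))
    (hm : ∀ {Z Z' : V} (c : Z' ⟶ Z) (p : P.functor.obj (op Z)),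
      m Z' (P.res c p) = Q.res (X ◁ c) (m Z p)) : (leftPart (hatBigraded V)).Hom X P Q :=
  show HatHom X (𝟙_ V) P Q from
  { app Z p := Q.res (ρ_ (X ⊗ Z)).hom (m Z p)
    naturality c p := by
      rw [hm, Q.res_res, Q.res_res]
      exact Q.res_congr (by simp) _ }

/-- The graded morphism with grade `(I, X')` given by a natural family `P Z → Q (Z ⊗ X')`. -/
def ofRight {X' : Vᴹᵒᵖ} {P Q : Hat V}
    (m : ∀ Z : V, P.functor.obj (op Z) → Q.functor.obj (op (Z ⊗ X'.unmop)))
    (hm : ∀ {Z Z' : V} (c : Z' ⟶ Z) (p : P.functor.obj (op Z)),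
      m Z' (P.res c p) = Q.res (c ▷ X'.unmop) (m Z p)) :
    (rightPart (hatBigraded V)).Hom X' P Q :=
  show HatHom (𝟙_ V) X'.unmop P Q from
  { app Z p := Q.res ((λ_ Z).hom ▷ X'.unmop) (m Z p)
    naturality c p := by
      rw [hm, Q.res_res, Q.res_res]
      refine Q.res_congr ?_ _
      rw [← comp_whiskerRight, ← comp_whiskerRight, leftUnitor_naturality] }

theorem left_ext {X : V} {P Q : Hat V} {φ ψ : (leftPart (hatBigraded V)).Hom X P Q}
    (h : ∀ (Z : V) (p : P.functor.obj (op Z)), leftApply φ p = leftApply ψ p) : φ = ψ :=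
  HatHom.ext (funext fun Z => funext fun p =>
    (Q.res_bijective (ρ_ (X ⊗ Z)).inv (ρ_ (X ⊗ Z)).hom (by simp) (by simp)).1 (h Z p))

theorem right_ext {X' : Vᴹᵒᵖ} {P Q : Hat V} {φ ψ : (rightPart (hatBigraded V)).Hom X' P Q}
    (h : ∀ (Z : V) (p : P.functor.obj (op Z)), rightApply φ p = rightApply ψ p) : φ = ψ :=
  HatHom.ext (funext fun Z => funext fun p =>
    (Q.res_bijective ((λ_ Z).inv ▷ X'.unmop) ((λ_ Z).hom ▷ X'.unmop)
      (by simp) (by simp)).1 (h Z p))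

@[simp]
theorem leftApply_ofLeft {X : V} {P Q : Hat V}
    (m : ∀ Z : V, P.functor.obj (op Z) → Q.functor.obj (op (X ⊗ Z)))
    (hm : ∀ {Z Z' : V} (c : Z' ⟶ Z) (p : P.functor.obj (op Z)),
      m Z' (P.res c p) = Q.res (X ◁ c) (m Z p)) {Z : V} (p : P.functor.obj (op Z)) :
    leftApply (ofLeft m hm) p = m Z p := by
  refine (Q.res_res _ _ _).trans ?_
  simp

@[simp]
theorem rightApply_ofRight {X' : Vᴹᵒᵖ} {P Q : Hat V}
    (m : ∀ Z : V, P.functor.obj (op Z) → Q.functor.obj (op (Z ⊗ X'.unmop)))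
    (hm : ∀ {Z Z' : V} (c : Z' ⟶ Z) (p : P.functor.obj (op Z)),
      m Z' (P.res c p) = Q.res (c ▷ X'.unmop) (m Z p)) {Z : V} (p : P.functor.obj (op Z)) :
    rightApply (ofRight m hm) p = m Z p := by
  refine (Q.res_res _ _ _).trans ?_
  simp

theorem leftApply_res {X : V} {P Q : Hat V} (φ : (leftPart (hatBigraded V)).Hom X P Q)
    {Z Z' : V} (c : Z' ⟶ Z) (p : P.functor.obj (op Z)) :
    leftApply φ (P.res c p) = Q.res (X ◁ c) (leftApply φ p) := by
  refine (congrArg (Q.res (ρ_ (X ⊗ Z')).inv) (HatHom.naturality φ c p)).trans ?_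
  refine (Q.res_res _ _ _).trans (Eq.trans (Q.res_congr ?_ _) (Q.res_res _ _ _).symm)
  change (ρ_ (X ⊗ Z')).inv ≫ ((X ◁ c) ▷ (𝟙_ V)) = X ◁ c ≫ (ρ_ (X ⊗ Z)).inv
  simp

theorem rightApply_res {X' : Vᴹᵒᵖ} {P Q : Hat V}
    (φ : (rightPart (hatBigraded V)).Hom X' P Q)
    {Z Z' : V} (c : Z' ⟶ Z) (p : P.functor.obj (op Z)) :
    rightApply φ (P.res c p) = Q.res (c ▷ X'.unmop) (rightApply φ p) := by
  refine (congrArg (Q.res ((λ_ Z').inv ▷ X'.unmop)) (HatHom.naturality φ c p)).trans ?_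
  refine (Q.res_res _ _ _).trans (Eq.trans (Q.res_congr ?_ _) (Q.res_res _ _ _).symm)
  change (λ_ Z').inv ▷ X'.unmop ≫ (((𝟙_ V) ◁ c) ▷ X'.unmop) = c ▷ X'.unmop ≫ (λ_ Z).inv ▷ X'.unmop
  rw [← comp_whiskerRight, ← comp_whiskerRight, leftUnitor_inv_naturality]

theorem leftApply_reindex {X Y : V} {P Q : Hat V} (a : Y ⟶ X)
    (φ : (leftPart (hatBigraded V)).Hom X P Q) {Z : V} (p : P.functor.obj (op Z)) :
    leftApply ((leftPart (hatBigraded V)).reindex a φ) p = Q.res (a ▷ Z) (leftApply φ p) := by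
  refine (Q.res_res _ _ _).trans (Eq.trans (Q.res_congr ?_ _) (Q.res_res _ _ _).symm)
  change (ρ_ (Y ⊗ Z)).inv ≫ ((a ▷ Z) ⊗ₘ 𝟙 (𝟙_ V)) = (a ▷ Z) ≫ (ρ_ (X ⊗ Z)).inv
  simp

theorem rightApply_reindex {X Y : Vᴹᵒᵖ} {P Q : Hat V} (a : Y ⟶ X)
    (φ : (rightPart (hatBigraded V)).Hom X P Q) {Z : V} (p : P.functor.obj (op Z)) :
    rightApply ((rightPart (hatBigraded V)).reindex a φ) p =
      Q.res (Z ◁ a.unmop) (rightApply φ p) := by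
  refine (Q.res_res _ _ _).trans (Eq.trans (Q.res_congr ?_ _) (Q.res_res _ _ _).symm)
  change (λ_ Z).inv ▷ Y.unmop ≫ ((𝟙 (𝟙_ V) ▷ Z) ⊗ₘ a.unmop) =
    Z ◁ a.unmop ≫ (λ_ Z).inv ▷ X.unmop
  rw [id_whiskerRight, id_tensorHom, whisker_exchange]

theorem leftApply_comp {X Y : V} {P Q R : Hat V} (ψ : (leftPart (hatBigraded V)).Hom Y Q R)
    (φ : (leftPart (hatBigraded V)).Hom X P Q) {Z : V} (p : P.functor.obj (op Z)) :
    leftApply ((leftPart (hatBigraded V)).comp ψ φ) p =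
      R.res (α_ Y X Z).hom (leftApply ψ (leftApply φ p)) := by
  rw [show leftApply ψ (leftApply φ p) =
    R.res (Y ◁ (ρ_ (X ⊗ Z)).inv) (leftApply ψ (HatHom.app φ Z p)) from leftApply_res ψ _ _]
  refine (R.res_res _ _ _).trans ((R.res_res _ _ _).trans ?_)
  refine Eq.trans (R.res_congr ?_ _) ((R.res_res _ _ _).symm.trans (R.res_res _ _ _).symm)
  change ((ρ_ ((Y ⊗ X) ⊗ Z)).inv ≫ ((𝟙 (Y ⊗ X) ▷ Z) ⊗ₘ (ρ_ (𝟙_ V)).inv)) ≫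
    sandwichComp X (𝟙_ V) Y (𝟙_ V) Z =
      ((α_ Y X Z).hom ≫ Y ◁ (ρ_ (X ⊗ Z)).inv) ≫ (ρ_ (Y ⊗ (X ⊗ Z) ⊗ 𝟙_ V)).inv
  unfold sandwichComp
  monoidal

theorem rightApply_comp {X Y : Vᴹᵒᵖ} {P Q R : Hat V}
    (ψ : (rightPart (hatBigraded V)).Hom Y Q R)
    (φ : (rightPart (hatBigraded V)).Hom X P Q) {Z : V} (p : P.functor.obj (op Z)) :
    rightApply ((rightPart (hatBigraded V)).comp ψ φ) p =
      R.res (α_ Z X.unmop Y.unmop).inv (rightApply ψ (rightApply φ p)) := by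
  rw [show rightApply ψ (rightApply φ p) =
    R.res ((λ_ Z).inv ▷ X.unmop ▷ Y.unmop) (rightApply ψ (HatHom.app φ Z p)) from
      rightApply_res ψ _ _]
  refine (R.res_res _ _ _).trans ((R.res_res _ _ _).trans ?_)
  refine Eq.trans (R.res_congr ?_ _) ((R.res_res _ _ _).symm.trans (R.res_res _ _ _).symm)
  change ((λ_ Z).inv ▷ (X.unmop ⊗ Y.unmop) ≫
    (((λ_ (𝟙_ V)).inv ▷ Z) ⊗ₘ (𝟙 (X.unmop ⊗ Y.unmop)))) ≫
    sandwichComp (𝟙_ V) X.unmop (𝟙_ V) Y.unmop Z = ((α_ Z X.unmop Y.unmop).inv ≫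
      (λ_ Z).inv ▷ X.unmop ▷ Y.unmop) ≫ (λ_ ((𝟙_ V ⊗ Z) ⊗ X.unmop)).inv ▷ Y.unmop
  unfold sandwichComp
  monoidal

theorem leftApply_id (P : Hat V) {Z : V} (p : P.functor.obj (op Z)) :
    leftApply ((leftPart (hatBigraded V)).id P) p = P.res (λ_ Z).hom p := by
  refine (P.res_res _ _ _).trans ((P.res_res _ _ _).trans (P.res_congr ?_ _))
  change ((ρ_ (𝟙_ V ⊗ Z)).inv ≫ ((𝟙 (𝟙_ V) ▷ Z) ⊗ₘ (𝟙 (𝟙_ V)))) ≫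
    (ρ_ (𝟙_ V ⊗ Z)).hom ≫ (λ_ Z).hom = (λ_ Z).hom
  simp

theorem rightApply_id (P : Hat V) {Z : V} (p : P.functor.obj (op Z)) :
    rightApply ((rightPart (hatBigraded V)).id P) p = P.res (ρ_ Z).hom p := by
  refine (P.res_res _ _ _).trans ((P.res_res _ _ _).trans (P.res_congr ?_ _))
  change ((λ_ Z).inv ▷ (𝟙_ V) ≫ ((𝟙 (𝟙_ V) ▷ Z) ⊗ₘ (𝟙 (𝟙_ V)))) ≫
    (ρ_ (𝟙_ V ⊗ Z)).hom ≫ (λ_ Z).hom = (ρ_ Z).hom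
  monoidal

theorem isBigradedSquare_hat_iff {X : V} {X' : Vᴹᵒᵖ} {P P' Q Q' : Hat V}
    (f : (leftPart (hatBigraded V)).Hom X P P') (g : (leftPart (hatBigraded V)).Hom X Q Q')
    (φ : (rightPart (hatBigraded V)).Hom X' P Q)
    (φ' : (rightPart (hatBigraded V)).Hom X' P' Q') :
    IsBigradedSquare (hatBigraded V) f g φ φ' ↔
      ∀ (Z : V) (p : P.functor.obj (op Z)), leftApply g (rightApply φ p) =
        Q'.res (α_ X Z X'.unmop).inv (rightApply φ' (leftApply f p)) := by
  have hr : ∀ (Z : V) (p : P.functor.obj (op Z)), rightApply φ' (leftApply f p) =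
      Q'.res ((ρ_ (X ⊗ Z)).inv ▷ X'.unmop) (rightApply φ' (HatHom.app f Z p)) :=
    fun Z p => rightApply_res φ' _ _
  have hl : ∀ (Z : V) (p : P.functor.obj (op Z)), leftApply g (rightApply φ p) =
      Q'.res (X ◁ ((λ_ Z).inv ▷ X'.unmop)) (leftApply g (HatHom.app φ Z p)) :=
    fun Z p => leftApply_res g _ _
  have kl : ∀ (Z : V) (p : P.functor.obj (op Z)),
      leftApply g (rightApply φ p) = Q'.res (α_ X Z X'.unmop).inv
        (HatHom.app (X := X) (Y := X'.unmop)
        ((hatBigraded V).reindex (X := (X, 𝟙_ Vᴹᵒᵖ) ⊗ (𝟙_ V, X')) (Y := (X, X'))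
          (Prod.mkHom (ρ_ X).inv (λ_ X').inv) ((hatBigraded V).comp g φ)) Z p) := by
    intro Z p
    rw [hl]
    refine (Q'.res_res _ _ _).trans (Eq.trans (Q'.res_congr ?_ _)
      ((Q'.res_res _ _ _).symm.trans (Q'.res_res _ _ _).symm))
    change X ◁ (λ_ Z).inv ▷ X'.unmop ≫ (ρ_ (X ⊗ ((𝟙_ V ⊗ Z) ⊗ X'.unmop))).inv =
      ((α_ X Z X'.unmop).inv ≫ (((ρ_ X).inv ▷ Z) ⊗ₘ (ρ_ X'.unmop).inv)) ≫
        sandwichComp (𝟙_ V) X'.unmop X (𝟙_ V) Z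
    unfold sandwichComp
    monoidal
  have kr : ∀ (Z : V) (p : P.functor.obj (op Z)),
      rightApply φ' (leftApply f p) = 
        (HatHom.app (X := X) (Y := X'.unmop)
        ((hatBigraded V).reindex (X := (𝟙_ V, X') ⊗ (X, 𝟙_ Vᴹᵒᵖ)) (Y := (X, X'))
          (Prod.mkHom (λ_ X).inv (ρ_ X').inv) ((hatBigraded V).comp φ' f)) Z p) := by
    intro Z p
    rw [hr]
    refine (Q'.res_res _ _ _).trans (Eq.trans (Q'.res_congr ?_ _) (Q'.res_res _ _ _).symm)
    change (ρ_ (X ⊗ Z)).inv ▷ X'.unmop ≫ (λ_ ((X ⊗ Z) ⊗ 𝟙_ V)).inv ▷ X'.unmop =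
      (((λ_ X).inv ▷ Z) ⊗ₘ (λ_ X'.unmop).inv) ≫ sandwichComp X (𝟙_ V) (𝟙_ V) X'.unmop Z
    unfold sandwichComp
    monoidal
  constructor
  · intro h Z p
    rw [kl, kr]
    exact congrArg (fun t => Q'.res (α_ X Z X'.unmop).inv
      (HatHom.app (X := X) (Y := X'.unmop) t Z p)) h
  · intro h
    refine HatHom.ext (funext fun Z => funext fun p =>
      (Q'.res_bijective (α_ X Z X'.unmop).inv (α_ X Z X'.unmop).hom (by simp) (by simp)).1 ?_)
    exact (kl Z p).symm.trans ((h Z p).trans (congrArg _ (kr Z p)))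

/-- The presheaf `X ↦ E(A . X; B)` on `V`, for objects `A` and `B` of a right `V`-graded
category `E`. -/
def homPresheaf (E : RightGradedCat.{u, w} V) (A B : E.Obj) : Hat V where
  functor :=
    { obj X := E.Hom (.mop X.unop) A B
      map c := ↾(fun f => E.reindex c.unop.mop f)
      map_id X := by
        ext f
        exact E.reindex_id f
      map_comp a b := by
        ext f
        exact E.reindex_comp b.unop.mop a.unop.mop f }

/-- The graded morphism `E(f, B)`, given by the maps `h ↦ h ∘ f`. -/
def homPre (E : RightGradedCat.{u, w} V) {X : V} {A A' : E.Obj} (f : E.Hom (.mop X) A' A)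
    (B : E.Obj) : (leftPart (hatBigraded V)).Hom X (homPresheaf E A B) (homPresheaf E A' B) :=
  ofLeft (P := homPresheaf E A B) (Q := homPresheaf E A' B)
    (fun _ h => E.comp h f) (fun c h => E.comp_reindex_left c.mop h f)

/-- The graded morphism `E(A, g)`, given by the maps `h ↦ g ∘ h`. -/
def homPost (E : RightGradedCat.{u, w} V) {X' : Vᴹᵒᵖ} (A : E.Obj) {B B' : E.Obj}
    (g : E.Hom X' B B') :
    (rightPart (hatBigraded V)).Hom X' (homPresheaf E A B) (homPresheaf E A B') :=
  ofRight (P := homPresheaf E A B) (Q := homPresheaf E A B')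
    (fun _ h => E.comp g h) (fun c h => E.comp_reindex_right c.mop g h)

theorem leftApply_homPre (E : RightGradedCat.{u, w} V) {X : V} {A A' : E.Obj}
    (f : E.Hom (.mop X) A' A) (B : E.Obj) {Z : V}
    (h : (homPresheaf E A B).functor.obj (op Z)) :
    leftApply (homPre E f B) h = E.comp h f :=
  leftApply_ofLeft (P := homPresheaf E A B) (Q := homPresheaf E A' B)
    (fun _ h => E.comp h f) (fun c h => E.comp_reindex_left c.mop h f) h

theorem rightApply_homPost (E : RightGradedCat.{u, w} V) {X' : Vᴹᵒᵖ} (A : E.Obj) {B B' : E.Obj}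
    (g : E.Hom X' B B') {Z : V} (h : (homPresheaf E A B).functor.obj (op Z)) :
    rightApply (homPost E A g) h = E.comp g h :=
  rightApply_ofRight (P := homPresheaf E A B) (Q := homPresheaf E A B')
    (fun _ h => E.comp g h) (fun c h => E.comp_reindex_right c.mop g h) h

/-- The hom bifunctor `E(-, ?) : E°, E ⟶ V̂` of a right `V`-graded category `E`. -/
def homBifunctor (E : RightGradedCat.{u, w} V) :
    GradedBifunctor (formalOp E) E (hatBigraded V) where
  obj A B := homPresheaf E A B
  mapLeft f B := homPre E f B
  mapRight A _ _ g := homPost E A g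
  mapLeft_reindex s f B := left_ext fun _ h =>
    (leftApply_homPre E _ B h).trans ((E.comp_reindex_right s.mop h f).trans
      ((congrArg _ (leftApply_homPre E f B h).symm).trans
        (leftApply_reindex s (homPre E f B) h).symm))
  mapLeft_comp g f B := left_ext fun _ h =>
    (leftApply_homPre E _ B h).trans ((E.assoc' h f g).trans
      ((congrArg _ ((congrArg (fun t => E.comp t g) (leftApply_homPre E f B h).symm).trans
        (leftApply_homPre E g B _).symm)).trans
        (leftApply_comp (homPre E g B) (homPre E f B) h).symm))
  mapLeft_id A B := left_ext fun _ h =>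
    (leftApply_homPre E _ B h).trans ((E.comp_id h).trans
      (leftApply_id (homPresheaf E A B) h).symm)
  mapRight_reindex A _ _ s g := right_ext fun _ h =>
    (rightApply_homPost E A _ h).trans ((E.comp_reindex_left s g h).trans
      ((congrArg _ (rightApply_homPost E A g h).symm).trans
        (rightApply_reindex s (homPost E A g) h).symm))
  mapRight_comp A _ _ _ g f := right_ext fun _ h =>
    (rightApply_homPost E A _ h).trans ((E.assoc g f h).trans
      ((congrArg _ ((congrArg (fun t => E.comp g t) (rightApply_homPost E A f h).symm).trans
        (rightApply_homPost E A g _).symm)).trans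
        (rightApply_comp (homPost E A g) (homPost E A f) h).symm))
  mapRight_id A B := right_ext fun _ h =>
    (rightApply_homPost E A _ h).trans ((E.id_comp h).trans
      (rightApply_id (homPresheaf E A B) h).symm)
  square {_ _ A A' B B'} f g := (isBigradedSquare_hat_iff _ _ _ _).2 fun _ h =>
    (leftApply_homPre E f B' _).trans ((congrArg (fun t => E.comp t f)
      (rightApply_homPost E A g h)).trans ((E.assoc g h f).trans
        (congrArg _ ((congrArg (fun t => E.comp g t) (leftApply_homPre E f B h).symm).trans
          (rightApply_homPost E A' g _).symm))))

/-- The action of a morphism of `V̂` on elements. -/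
def Hat.app {P Q : Hat V} (α : P ⟶ Q) {X : V} (p : P.functor.obj (op X)) :
    Q.functor.obj (op X) :=
  α.natTrans.app (op X) p

theorem Hat.app_res {P Q : Hat V} (α : P ⟶ Q) {X Y : V} (c : Y ⟶ X)
    (p : P.functor.obj (op X)) : Hat.app α (P.res c p) = Q.res c (Hat.app α p) :=
  ConcreteCategory.congr_hom (α.natTrans.naturality c.op) p

theorem Hat.app_comp {P Q R : Hat V} (α : P ⟶ Q) (β : Q ⟶ R) {X : V}
    (p : P.functor.obj (op X)) : Hat.app (α ≫ β) p = Hat.app β (Hat.app α p) := rfl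

@[simp]
theorem Hat.app_id (P : Hat V) {X : V} (p : P.functor.obj (op X)) : Hat.app (𝟙 P) p = p := rfl

theorem Hat.hom_ext {P Q : Hat V} {α β : P ⟶ Q}
    (h : ∀ (X : V) (p : P.functor.obj (op X)), Hat.app α p = Hat.app β p) : α = β := by
  ext X p
  exact h X.unop p

theorem type_hom_congr {A B : Type u} {f g : A ⟶ B} (h : f = g) (x : A) : f x = g x := by
  rw [h]

/-- The universal maps `P X × Q Y → (P ⊗ Q) (X ⊗ Y)` of Day convolution. -/
noncomputable def dayMul {P Q : Hat V} {X Y : V} (p : P.functor.obj (op X)) (q : Q.functor.obj (op Y)) :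
    (P ⊗ Q).functor.obj (op (X ⊗ Y)) :=
  (DayFunctor.η P Q).app (op X, op Y) (p, q)

variable (V) in
/-- The universal element of the unit object of `V̂`. -/
noncomputable def dayUnit : (𝟙_ (Hat V)).functor.obj (op (𝟙_ V)) :=
  DayFunctor.ν Vᵒᵖ (Type u) PUnit.unit

theorem dayMul_res {P Q : Hat V} {X X' Y Y' : V} (a : X' ⟶ X) (b : Y' ⟶ Y)
    (p : P.functor.obj (op X)) (q : Q.functor.obj (op Y)) :
    dayMul (P.res a p) (Q.res b q) = (P ⊗ Q).res (a ⊗ₘ b) (dayMul p q) :=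
  type_hom_congr (A := P.functor.obj (op X) × Q.functor.obj (op Y))
    ((DayFunctor.η P Q).naturality (X := (op X, op Y)) (Y := (op X', op Y'))
      (Prod.mkHom a.op b.op)) (p, q)

theorem dayMul_res_left {P Q : Hat V} {X X' Y : V} (a : X' ⟶ X) (p : P.functor.obj (op X))
    (q : Q.functor.obj (op Y)) : dayMul (P.res a p) q = (P ⊗ Q).res (a ▷ Y) (dayMul p q) := by
  rw [← tensorHom_id, ← dayMul_res, Q.res_id]

theorem dayMul_res_right {P Q : Hat V} {X Y Y' : V} (b : Y' ⟶ Y) (p : P.functor.obj (op X))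
    (q : Q.functor.obj (op Y)) : dayMul p (Q.res b q) = (P ⊗ Q).res (X ◁ b) (dayMul p q) := by
  rw [← id_tensorHom, ← dayMul_res, P.res_id]

theorem app_tensorHom {P P' Q Q' : Hat V} (α : P ⟶ P') (β : Q ⟶ Q') {X Y : V}
    (p : P.functor.obj (op X)) (q : Q.functor.obj (op Y)) :
    Hat.app (α ⊗ₘ β) (dayMul p q) = dayMul (Hat.app α p) (Hat.app β q) :=
  type_hom_congr (A := P.functor.obj (op X) × Q.functor.obj (op Y))
    (LawfulDayConvolutionMonoidalCategoryStruct.convolutionExtensionUnit_comp_ι_map_tensorHom_app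
      Vᵒᵖ (Type u) α β (op X) (op Y)) (p, q)

theorem app_whiskerRight {P P' : Hat V} (α : P ⟶ P') (Q : Hat V) {X Y : V}
    (p : P.functor.obj (op X)) (q : Q.functor.obj (op Y)) :
    Hat.app (α ▷ Q) (dayMul p q) = dayMul (Hat.app α p) q := by
  rw [← tensorHom_id, app_tensorHom, Hat.app_id]

theorem app_whiskerLeft (P : Hat V) {Q Q' : Hat V} (β : Q ⟶ Q') {X Y : V}
    (p : P.functor.obj (op X)) (q : Q.functor.obj (op Y)) :
    Hat.app (P ◁ β) (dayMul p q) = dayMul p (Hat.app β q) := by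
  rw [← id_tensorHom, app_tensorHom, Hat.app_id]

theorem app_associator {P Q R : Hat V} {X Y Z : V} (p : P.functor.obj (op X))
    (q : Q.functor.obj (op Y)) (r : R.functor.obj (op Z)) :
    Hat.app (α_ P Q R).hom (dayMul (dayMul p q) r) =
      (P ⊗ Q ⊗ R).res (α_ X Y Z).hom (dayMul p (dayMul q r)) :=
  type_hom_congr (A := (P.functor.obj (op X) × Q.functor.obj (op Y)) × R.functor.obj (op Z))
    (LawfulDayConvolutionMonoidalCategoryStruct.associator_hom_unit_unit
      (C := Vᵒᵖ) (Type u) P Q R (op X) (op Y) (op Z)) ((p, q), r)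

theorem app_leftUnitor {P : Hat V} {X : V} (p : P.functor.obj (op X)) :
    Hat.app (λ_ P).hom (dayMul (dayUnit V) p) = P.res (λ_ X).hom p :=
  type_hom_congr (A := PUnit.{u + 1} × P.functor.obj (op X))
    (LawfulDayConvolutionMonoidalCategoryStruct.leftUnitor_hom_unit_app
      (C := Vᵒᵖ) (Type u) P (op X)) (PUnit.unit, p)

theorem app_rightUnitor {P : Hat V} {X : V} (p : P.functor.obj (op X)) :
    Hat.app (ρ_ P).hom (dayMul p (dayUnit V)) = P.res (ρ_ X).hom p :=
  type_hom_congr (A := P.functor.obj (op X) × PUnit.{u + 1})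
    (LawfulDayConvolutionMonoidalCategoryStruct.rightUnitor_hom_unit_app
      (C := Vᵒᵖ) (Type u) P (op X)) (p, PUnit.unit)

theorem dayMul_hom_ext {P Q R : Hat V} {α β : P ⊗ Q ⟶ R}
    (h : ∀ (X Y : V) (p : P.functor.obj (op X)) (q : Q.functor.obj (op Y)),
      Hat.app α (dayMul p q) = Hat.app β (dayMul p q)) : α = β :=
  DayFunctor.tensor_hom_ext fun X Y => by
    ext ⟨p, q⟩
    exact h X.unop Y.unop p q

/-- The morphism `P ⊗ Q ⟶ R` determined by a natural family of maps `P X × Q Y → R (X ⊗ Y)`. -/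
noncomputable def dayDesc {P Q R : Hat V}
    (m : ∀ X Y : V, P.functor.obj (op X) → Q.functor.obj (op Y) → R.functor.obj (op (X ⊗ Y)))
    (hm : ∀ {X X' Y Y' : V} (a : X' ⟶ X) (b : Y' ⟶ Y) (p : P.functor.obj (op X))
      (q : Q.functor.obj (op Y)), m X' Y' (P.res a p) (Q.res b q) = R.res (a ⊗ₘ b) (m X Y p q)) :
    P ⊗ Q ⟶ R :=
  DayFunctor.tensorDesc
    { app Z := ↾(fun t => m Z.1.unop Z.2.unop t.1 t.2)
      naturality Z Z' c := by
        ext t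
        exact hm c.1.unop c.2.unop t.1 t.2 }

theorem app_dayDesc {P Q R : Hat V}
    (m : ∀ X Y : V, P.functor.obj (op X) → Q.functor.obj (op Y) → R.functor.obj (op (X ⊗ Y)))
    (hm : ∀ {X X' Y Y' : V} (a : X' ⟶ X) (b : Y' ⟶ Y) (p : P.functor.obj (op X))
      (q : Q.functor.obj (op Y)), m X' Y' (P.res a p) (Q.res b q) = R.res (a ⊗ₘ b) (m X Y p q))
    {X Y : V} (p : P.functor.obj (op X)) (q : Q.functor.obj (op Y)) :
    Hat.app (dayDesc m hm) (dayMul p q) = m X Y p q :=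
  type_hom_congr (A := P.functor.obj (op X) × Q.functor.obj (op Y))
    (DayFunctor.η_comp_tensorDesc_app _ (op X) (op Y)) (p, q)

/-- The right `V`-graded category underlying a `V̂`-category: a graded morphism from `A` to `B`
with grade `X` is an element of the hom-object at `X`. -/
noncomputable def ofEnriched (B : Type w) [EnrichedCategory (Hat V) B] : RightGradedCat.{u, w} V where
  Obj := B
  Hom X A A' := (A ⟶[Hat V] A').functor.obj (op X.unmop)
  reindex {_ _ A A'} a f := (A ⟶[Hat V] A').res a.unmop f
  comp {_ _ A A' A''} g f := Hat.app (eComp (Hat V) A A' A'') (dayMul f g)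
  id A := Hat.app (eId (Hat V) A) (dayUnit V)
  reindex_id f := Hat.res_id _ _
  reindex_comp a b f := (Hat.res_res _ _ _ _).symm
  comp_reindex b a g f := by
    rw [dayMul_res, Hat.app_res]
    rfl
  assoc {X Y Z A A' A'' A'''} h g f := by
    have e := congrArg (fun t => Hat.app t (dayMul (dayMul f g) h))
      (e_assoc' (Hat V) A A' A'' A''')
    simp only [Hat.app_comp, app_associator, app_whiskerRight, Hat.app_res, app_whiskerLeft] at e
    have e2 := congrArg ((A ⟶[Hat V] A''').res (α_ X.unmop Y.unmop Z.unmop).inv) e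
    rw [Hat.res_res, Iso.inv_hom_id, Hat.res_id] at e2
    exact e2
  comp_id {X A A'} f := by
    have e := e_id_comp (Hat V) A A'
    rw [Iso.inv_comp_eq, Category.comp_id] at e
    have e2 := congrArg (fun t => Hat.app t (dayMul (dayUnit V) f)) e
    simp only [Hat.app_comp, app_whiskerRight, app_leftUnitor] at e2
    exact e2
  id_comp {X A A'} f := by
    have e := e_comp_id (Hat V) A A'
    rw [Iso.inv_comp_eq, Category.comp_id] at e
    have e2 := congrArg (fun t => Hat.app t (dayMul f (dayUnit V))) e
    simp only [Hat.app_comp, app_whiskerLeft, app_rightUnitor] at e2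
    exact e2

/-- The right `V`-graded functor underlying a `V̂`-functor. -/
def ofEnrichedFunctor {B : Type w₁} [EnrichedCategory (Hat V) B] {C : Type w₂}
    [EnrichedCategory (Hat V) C] (F : EnrichedFunctor (Hat V) B C) :
    GradedFunctor (ofEnriched (V := V) B) (ofEnriched (V := V) C) where
  obj := F.obj
  map {_ A A'} f := Hat.app (F.map A A') f
  map_reindex a f := Hat.app_res _ _ _
  map_comp {_ _ A A' A''} g f := by
    have e := congrArg (fun t => Hat.app t (dayMul f g)) (F.map_comp A A' A'')
    exact e.trans (congrArg (Hat.app _) (app_tensorHom _ _ _ _))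
  map_id A := congrArg (fun t => Hat.app t (dayUnit V)) (F.map_id A)

section Modules

variable {M : Type w₁} [Category.{w₂} M] [MonoidalCategory M] {C : Type w₃}
  [EnrichedCategory M C]

variable (M C) in
/-- An `M`-module `𝕀 -|-> C` on the `M`-category `C`: a family of objects of `M` with a left action
of `C`. (The right action of the unit `M`-category `𝕀` on such a family is forced by the unit law
to be the right unitor, and is therefore omitted.) -/
@[ext]
structure PshModule where
  obj : C → M
  act : ∀ A' A : C, (A' ⟶[M] A) ⊗ obj A ⟶ obj A'
  id_act : ∀ A : C, (eId M A ▷ obj A) ≫ act A A = (λ_ (obj A)).hom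
  comp_act : ∀ A'' A' A : C, (eComp M A'' A' A ▷ obj A) ≫ act A'' A =
    (α_ (A'' ⟶[M] A') (A' ⟶[M] A) (obj A)).hom ≫ ((A'' ⟶[M] A') ◁ act A' A) ≫ act A'' A'

/-- The family `φ A : F A ⊗ X ⟶ G A` commutes with the actions of `C`, i.e. it is a transformation
`F ⊗ X ⟶ G`. -/
def IsTrans (F G : PshModule M C) {X : M} (φ : ∀ A : C, F.obj A ⊗ X ⟶ G.obj A) : Prop :=
  ∀ A' A : C, (F.act A' A ▷ X) ≫ φ A' =
    (α_ (A' ⟶[M] A) (F.obj A) X).hom ≫ ((A' ⟶[M] A) ◁ φ A) ≫ G.act A' A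

/-- A right lifting `G^F` of `G` along `F`: a universal transformation `ε : F ⊗ G^F ⟶ G`. -/
structure RightLifting (F G : PshModule M C) where
  obj : M
  ε : ∀ A : C, F.obj A ⊗ obj ⟶ G.obj A
  isTrans : IsTrans F G ε
  lift : ∀ {X : M} (φ : ∀ A : C, F.obj A ⊗ X ⟶ G.obj A), IsTrans F G φ → (X ⟶ obj)
  fac : ∀ {X : M} (φ : ∀ A : C, F.obj A ⊗ X ⟶ G.obj A) (h : IsTrans F G φ) (A : C),
    (F.obj A ◁ lift φ h) ≫ ε A = φ A
  uniq : ∀ {X : M} (a b : X ⟶ obj), (∀ A : C, (F.obj A ◁ a) ≫ ε A = (F.obj A ◁ b) ≫ ε A) → a = b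

theorem isTrans_id (F : PshModule M C) : IsTrans F F (fun A => (ρ_ (F.obj A)).hom) := by
  intro A' A
  simp

theorem IsTrans.comp {F G H : PshModule M C} {X Y : M} {φ : ∀ A : C, F.obj A ⊗ X ⟶ G.obj A}
    {ψ : ∀ A : C, G.obj A ⊗ Y ⟶ H.obj A} (hφ : IsTrans F G φ) (hψ : IsTrans G H ψ) :
    IsTrans F H (fun A => (α_ (F.obj A) X Y).inv ≫ (φ A ▷ Y) ≫ ψ A) := by
  intro A' A
  have h1 := hφ A' A
  have h2 := hψ A' A
  calc (F.act A' A ▷ (X ⊗ Y)) ≫ (α_ (F.obj A') X Y).inv ≫ (φ A' ▷ Y) ≫ ψ A'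
      = (α_ _ X Y).inv ≫ ((F.act A' A ▷ X ≫ φ A') ▷ Y) ≫ ψ A' := by simp
    _ = _ := by
      rw [h1]
      simp [h2]

/-- Street's `M`-category of presheaves on `C`, whose hom-objects are right liftings: composition
and identities are induced by the universal property. -/
abbrev presheafEnriched (R : ∀ F G : PshModule M C, RightLifting F G) :
    EnrichedCategory M (PshModule M C) where
  Hom F G := (R F G).obj
  id F := (R F F).lift _ (isTrans_id F)
  comp F G H := (R F H).lift _ ((R F G).isTrans.comp (R G H).isTrans)
  id_comp F G := by
    apply (R F G).uniq
    intro A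
    simp only [MonoidalCategory.whiskerLeft_comp, Category.assoc, (R F G).fac]
    rw [associator_inv_naturality_middle_assoc, ← comp_whiskerRight_assoc, (R F F).fac]
    simp
  comp_id F G := by
    apply (R F G).uniq
    intro A
    simp only [MonoidalCategory.whiskerLeft_comp, Category.assoc, (R F G).fac]
    rw [associator_inv_naturality_right_assoc, whisker_exchange_assoc, (R G G).fac]
    simp
  assoc F G H K := by
    apply (R F K).uniq
    intro A
    simp only [MonoidalCategory.whiskerLeft_comp, Category.assoc, (R F K).fac]
    rw [associator_inv_naturality_middle_assoc, ← comp_whiskerRight_assoc, (R F H).fac,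
      associator_inv_naturality_right_assoc, whisker_exchange_assoc, (R G K).fac]
    simp

end Modules

theorem exists_dayMul {P Q : Hat V} {W : V} (t : (P ⊗ Q).functor.obj (op W)) :
    ∃ (X Y : V) (c : W ⟶ X ⊗ Y) (p : P.functor.obj (op X)) (q : Q.functor.obj (op Y)),
      t = (P ⊗ Q).res c (dayMul p q) := by
  have hc := (LawfulDayConvolutionMonoidalCategoryStruct.isPointwiseLeftKanExtensionConvolutionExtensionUnit
    (C := Vᵒᵖ) (V := Type u) P Q) (op W)
  obtain ⟨j, y, hy⟩ := Limits.Types.jointly_surjective_of_isColimit hc t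
  exact ⟨j.left.1.unop, j.left.2.unop, j.hom.unop, y.1, y.2, hy.symm⟩

theorem dayMul_hom_ext₃ {P Q R S : Hat V} {α β : (P ⊗ Q) ⊗ R ⟶ S}
    (h : ∀ (X Y Z : V) (p : P.functor.obj (op X)) (q : Q.functor.obj (op Y))
      (r : R.functor.obj (op Z)),
      Hat.app α (dayMul (dayMul p q) r) = Hat.app β (dayMul (dayMul p q) r)) : α = β := by
  apply dayMul_hom_ext
  intro W Z t r
  obtain ⟨X, Y, c, p, q, rfl⟩ := exists_dayMul t
  rw [dayMul_res_left, Hat.app_res, Hat.app_res, h]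

section Liftings

variable {B : Type u} [EnrichedCategory (Hat V) B]

/-- The elements at `X` of the hom-object from `F` to `G` of Street's presheaf `V̂`-category: the
families of natural maps `F A Z → G A (Z ⊗ X)` that commute with the actions. -/
@[ext]
structure LiftingElement (F G : PshModule (Hat V) B) (X : V) where
  app : ∀ (A : B) (Z : V), (F.obj A).functor.obj (op Z) → (G.obj A).functor.obj (op (Z ⊗ X))
  naturality : ∀ (A : B) {Z Z' : V} (c : Z' ⟶ Z) (p : (F.obj A).functor.obj (op Z)),
    app A Z' ((F.obj A).res c p) = (G.obj A).res (c ▷ X) (app A Z p)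
  act : ∀ (A' A : B) {Y Z : V} (f : (A' ⟶[Hat V] A).functor.obj (op Y))
    (p : (F.obj A).functor.obj (op Z)),
    app A' (Y ⊗ Z) (Hat.app (F.act A' A) (dayMul f p)) =
      (G.obj A').res (α_ Y Z X).hom (Hat.app (G.act A' A) (dayMul f (app A Z p)))

/-- The restriction of an element of the hom-object along a morphism of `V`. -/
noncomputable def LiftingElement.res {F G : PshModule (Hat V) B} {X X' : V} (c : X' ⟶ X)
    (φ : LiftingElement F G X) : LiftingElement F G X' where
  app A Z p := (G.obj A).res (Z ◁ c) (φ.app A Z p)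
  naturality A _ _ d p := by
    rw [φ.naturality, Hat.res_res, Hat.res_res, whisker_exchange]
  act A' A Y Z f p := by
    rw [φ.act, dayMul_res_right, Hat.app_res, Hat.res_res, Hat.res_res]
    exact Hat.res_congr _ (by simp) _

theorem LiftingElement.res_id {F G : PshModule (Hat V) B} {X : V} (φ : LiftingElement F G X) :
    φ.res (𝟙 X) = φ := by
  ext A Z p
  simp [LiftingElement.res]

theorem LiftingElement.res_comp {F G : PshModule (Hat V) B} {X Y Z : V} (a : Z ⟶ Y) (b : Y ⟶ X)
    (φ : LiftingElement F G X) : φ.res (a ≫ b) = (φ.res b).res a := by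
  ext A Z p
  simp [LiftingElement.res, Hat.res_res]

/-- The hom-object from `F` to `G` of Street's presheaf `V̂`-category. -/
noncomputable def liftingObj (F G : PshModule (Hat V) B) : Hat V where
  functor :=
    { obj X := LiftingElement F G X.unop
      map c := ↾(fun φ => LiftingElement.res c.unop φ)
      map_id X := by
        apply ConcreteCategory.hom_ext
        intro φ
        exact LiftingElement.res_id φ
      map_comp a b := by
        apply ConcreteCategory.hom_ext
        intro φ
        exact LiftingElement.res_comp b.unop a.unop φ }

theorem app_isTrans {F G : PshModule (Hat V) B} {P : Hat V} {χ : ∀ A : B, F.obj A ⊗ P ⟶ G.obj A}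
    (h : IsTrans F G χ) {A' A : B} {X Y Z : V} (f : (A' ⟶[Hat V] A).functor.obj (op Y))
    (p : (F.obj A).functor.obj (op Z)) (x : P.functor.obj (op X)) :
    Hat.app (χ A') (dayMul (Hat.app (F.act A' A) (dayMul f p)) x) =
      (G.obj A').res (α_ Y Z X).hom
        (Hat.app (G.act A' A) (dayMul f (Hat.app (χ A) (dayMul p x)))) := by
  have e := congrArg (fun t => Hat.app t (dayMul (dayMul f p) x)) (h A' A)
  simp only [Hat.app_comp, app_associator, app_whiskerRight, Hat.app_res, app_whiskerLeft] at e
  exact e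

/-- The element of the hom-object determined by an element `x` of an object `X` and a transformation
`F ⊗ X ⟶ G`. -/
noncomputable def liftingElement {F G : PshModule (Hat V) B} {P : Hat V}
    (χ : ∀ A : B, F.obj A ⊗ P ⟶ G.obj A) (h : IsTrans F G χ) {X : V}
    (x : P.functor.obj (op X)) : LiftingElement F G X where
  app A Z p := Hat.app (χ A) (dayMul p x)
  naturality A Z Z' c p := by
    rw [dayMul_res_left, Hat.app_res]
  act A' A Y Z f p := by
    exact app_isTrans h f p x

theorem LiftingElement.app_res {F G : PshModule (Hat V) B} (A : B) {X X' Y Y' : V} (a : X' ⟶ X)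
    (b : Y' ⟶ Y) (p : (F.obj A).functor.obj (op X)) (φ : LiftingElement F G Y) :
    (φ.res b).app A X' ((F.obj A).res a p) = (G.obj A).res (a ⊗ₘ b) (φ.app A X p) := by
  change (G.obj A).res (X' ◁ b) (φ.app A X' ((F.obj A).res a p)) = _
  rw [φ.naturality, Hat.res_res, MonoidalCategory.tensorHom_def']

/-- The evaluation `F A ⊗ G^F ⟶ G A`. -/
noncomputable def liftingEval (F G : PshModule (Hat V) B) (A : B) :
    F.obj A ⊗ liftingObj F G ⟶ G.obj A :=
  dayDesc (Q := liftingObj F G) (fun Z X p (φ : LiftingElement F G X) => φ.app A Z p)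
    (fun a b p φ => LiftingElement.app_res A a b p φ)

theorem app_liftingEval {F G : PshModule (Hat V) B} {A : B} {Z X : V}
    (p : (F.obj A).functor.obj (op Z)) (φ : LiftingElement F G X) :
    Hat.app (liftingEval F G A) (dayMul (Q := liftingObj F G) p φ) = φ.app A Z p :=
  app_dayDesc (Q := liftingObj F G) (fun Z X p (φ : LiftingElement F G X) => φ.app A Z p)
    (fun a b p φ => LiftingElement.app_res A a b p φ) p φ

/-- Right liftings along modules over a small `V̂`-category exist. -/
noncomputable def dayRightLifting (F G : PshModule (Hat V) B) : RightLifting F G where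
  obj := liftingObj F G
  ε := liftingEval F G
  isTrans A' A := dayMul_hom_ext₃ fun Y Z X f p φ => by
    simp only [Hat.app_comp, app_associator, app_whiskerRight, Hat.app_res,
      app_whiskerLeft]
    refine (app_liftingEval _ φ).trans ((LiftingElement.act φ A' A f p).trans ?_)
    exact congrArg (fun t => (G.obj A').res _ (Hat.app (G.act A' A) (dayMul f t)))
      (app_liftingEval p φ).symm
  lift {X} χ h := .mk
    { app Y := ↾(fun x => liftingElement χ h x)
      naturality Y Y' c := by
        apply ConcreteCategory.hom_ext
        intro x
        exact LiftingElement.ext (funext fun A => funext fun Z => funext fun p =>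
          (congrArg (Hat.app (χ A)) (dayMul_res_right c.unop p x)).trans (Hat.app_res _ _ _)) }
  fac {X} χ h A := dayMul_hom_ext fun Z Y p x => by
    rw [Hat.app_comp, app_whiskerLeft]
    exact app_liftingEval p (liftingElement χ h x)
  uniq a b h := Hat.hom_ext fun Y x => LiftingElement.ext (funext fun A => funext fun Z =>
    funext fun p => by
      have e := congrArg (fun t => Hat.app t (dayMul p x)) (h A)
      simp only [Hat.app_comp, app_whiskerLeft] at e
      exact (app_liftingEval p (Hat.app a x)).symm.trans (e.trans
        (app_liftingEval p (Hat.app b x))))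

/-- Street's presheaf `V̂`-category `𝓟B` on a small `V̂`-category `B`. -/
noncomputable instance : EnrichedCategory (Hat V) (PshModule (Hat V) B) :=
  presheafEnriched dayRightLifting

end Liftings

section Street

variable {M : Type w₁} [Category.{w₂} M] [MonoidalCategory M] {C : Type w₃}
  [EnrichedCategory M C]

/-- The representable module `C(-, A)`. -/
def representable (A : C) : PshModule M C where
  obj A' := A' ⟶[M] A
  act A'' A' := eComp M A'' A' A
  id_act A' := by
    have e := e_id_comp M A' A
    rwa [Iso.inv_comp_eq, Category.comp_id] at e
  comp_act A''' A'' A' := (e_assoc' M A''' A'' A' A).symm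

theorem isTrans_eComp (A B : C) :
    IsTrans (representable (M := M) A) (representable B) (X := A ⟶[M] B)
      (fun A' => eComp M A' A B) :=
  fun A'' A' => (e_assoc' M A'' A' A B).symm

/-- The transpose `C(A, B) ⟶ C(-, B)^C(-, A)` of the composition morphisms. -/
def streetMap (R : ∀ F G : PshModule M C, RightLifting F G) (A B : C) :
    (A ⟶[M] B) ⟶ (R (representable A) (representable B)).obj :=
  (R (representable A) (representable B)).lift _ (isTrans_eComp A B)

theorem streetMap_fac (R : ∀ F G : PshModule M C, RightLifting F G) (A' A B : C) :
    ((A' ⟶[M] A) ◁ streetMap R A B) ≫ (show (A' ⟶[M] A) ⊗ _ ⟶ (A' ⟶[M] B) from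
      (R (representable A) (representable B)).ε A') = eComp M A' A B :=
  (R (representable A) (representable B)).fac _ (isTrans_eComp A B) A'

theorem streetMap_id (R : ∀ F G : PshModule M C, RightLifting F G) (A : C) :
    eId M A ≫ streetMap R A A = (R (representable A) (representable A)).lift _
      (isTrans_id (representable A)) := by
  apply (R (representable A) (representable A)).uniq
  intro A'
  refine Eq.trans ?_ ((R (representable A) (representable A)).fac _ (isTrans_id _) A').symm
  have e := e_comp_id M A' A
  rw [Iso.inv_comp_eq, Category.comp_id, ← streetMap_fac R, ← Category.assoc,
    ← MonoidalCategory.whiskerLeft_comp] at e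
  exact e

theorem whisker_assoc_aux {P X Y Z Q S X' Y' : M} (c : X ⊗ Y ⟶ Z) (w : P ⊗ Z ⟶ S)
    (a : X ⟶ X') (b : Y ⟶ Y') (u : P ⊗ X' ⟶ Q) (v : Q ⊗ Y' ⟶ S)
    (e : (α_ P X Y).hom ≫ (P ◁ c) ≫ w = (((P ◁ a) ≫ u) ▷ Y) ≫ (Q ◁ b) ≫ v) :
    (P ◁ c) ≫ w = (P ◁ (a ⊗ₘ b)) ≫ (α_ P X' Y').inv ≫ (u ▷ Y') ≫ v := by
  rw [← cancel_epi (α_ P X Y).hom, e, MonoidalCategory.tensorHom_def]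
  simp only [Category.assoc, comp_whiskerRight, MonoidalCategory.whiskerLeft_comp]
  rw [associator_inv_naturality_right_assoc, whisker_exchange_assoc,
    associator_inv_naturality_middle_assoc, Iso.hom_inv_id_assoc]

theorem streetMap_comp (R : ∀ F G : PshModule M C, RightLifting F G) (A B D : C) :
    eComp M A B D ≫ streetMap R A D = (streetMap R A B ⊗ₘ streetMap R B D) ≫
      (R (representable A) (representable D)).lift _
        ((R (representable A) (representable B)).isTrans.comp
          (R (representable B) (representable D)).isTrans) := by
  apply (R (representable A) (representable D)).uniq
  intro A'
  rw [MonoidalCategory.whiskerLeft_comp ((representable A).obj A') (streetMap R A B ⊗ₘ _),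
    Category.assoc, (R (representable A) (representable D)).fac]
  rw [MonoidalCategory.whiskerLeft_comp, Category.assoc]
  have e := e_assoc' M A' A B D
  rw [← streetMap_fac R A' A D, ← streetMap_fac R A' A B, ← streetMap_fac R A' B D] at e
  exact whisker_assoc_aux _ _ _ _ _ _ e

/-- Street's Yoneda embedding `A ↦ C(-, A)`. -/
def streetYoneda (R : ∀ F G : PshModule M C, RightLifting F G) :
    letI := presheafEnriched R
    EnrichedFunctor M C (PshModule M C) :=
  letI := presheafEnriched R
  { obj A := representable A
    map A B := streetMap R A B
    map_id A := streetMap_id R A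
    map_comp A B D := streetMap_comp R A B D }

end Street

section Comparison

variable {B : Type u} [EnrichedCategory (Hat V) B]

theorem app_act_comp (F : PshModule (Hat V) B) (A'' A' A : B) {X Y Z : V}
    (g : (A'' ⟶[Hat V] A').functor.obj (op Y)) (f : (A' ⟶[Hat V] A).functor.obj (op X))
    (p : (F.obj A).functor.obj (op Z)) :
    Hat.app (F.act A'' A) (dayMul (Hat.app (eComp (Hat V) A'' A' A) (dayMul g f)) p) =
      (F.obj A'').res (α_ Y X Z).hom
        (Hat.app (F.act A'' A') (dayMul g (Hat.app (F.act A' A) (dayMul f p)))) := by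
  have e := congrArg (fun t => Hat.app t (dayMul (dayMul g f) p)) (F.comp_act A'' A' A)
  simp only [Hat.app_comp, app_associator, app_whiskerRight, Hat.app_res, app_whiskerLeft] at e
  exact e

theorem app_act_id (F : PshModule (Hat V) B) (A : B) {Z : V}
    (p : (F.obj A).functor.obj (op Z)) :
    Hat.app (F.act A A) (dayMul (Hat.app (eId (Hat V) A) (dayUnit V)) p) =
      (F.obj A).res (λ_ Z).hom p := by
  have e := congrArg (fun t => Hat.app t (dayMul (dayUnit V) p)) (F.id_act A)
  simp only [Hat.app_comp, app_whiskerRight, app_leftUnitor] at e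
  exact e

theorem app_ε_comp (R : ∀ F G : PshModule (Hat V) B, RightLifting F G)
    {F G H : PshModule (Hat V) B} (A : B) {X Y Z : V} (p : (F.obj A).functor.obj (op Z))
    (φ : (R F G).obj.functor.obj (op X)) (ψ : (R G H).obj.functor.obj (op Y)) :
    Hat.app ((R F H).ε A) (dayMul p (Hat.app ((R F H).lift _
      ((R F G).isTrans.comp (R G H).isTrans)) (dayMul φ ψ))) =
      (H.obj A).res (α_ Z X Y).inv
        (Hat.app ((R G H).ε A) (dayMul (Hat.app ((R F G).ε A) (dayMul p φ)) ψ)) := by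
  have e := (R F H).fac _ ((R F G).isTrans.comp (R G H).isTrans) A
  rw [← cancel_epi (α_ _ _ _).hom, Iso.hom_inv_id_assoc] at e
  have e2 := congrArg (fun t => Hat.app t (dayMul (dayMul p φ) ψ)) e
  simp only [Hat.app_comp, app_associator, app_whiskerRight, Hat.app_res, app_whiskerLeft] at e2
  rw [← e2, Hat.res_res, Iso.inv_hom_id, Hat.res_id]

theorem app_ε_id (R : ∀ F G : PshModule (Hat V) B, RightLifting F G)
    {F : PshModule (Hat V) B} (A : B) {Z : V} (p : (F.obj A).functor.obj (op Z)) :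
    Hat.app ((R F F).ε A) (dayMul p (Hat.app ((R F F).lift _ (isTrans_id F)) (dayUnit V))) =
      (F.obj A).res (ρ_ Z).hom p := by
  have e := congrArg (fun t => Hat.app t (dayMul p (dayUnit V)))
    ((R F F).fac _ (isTrans_id F) A)
  simp only [Hat.app_comp, app_whiskerLeft, app_rightUnitor] at e
  exact e

/-- The graded morphism `p ↦ f · p` determined by an element `f` acting on a module. -/
noncomputable def actLeft (F : PshModule (Hat V) B) {X : V} {A' A : B}
    (f : (A' ⟶[Hat V] A).functor.obj (op X)) :
    (leftPart (hatBigraded V)).Hom X (F.obj A) (F.obj A') :=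
  ofLeft (P := F.obj A) (Q := F.obj A') (fun _ p => Hat.app (F.act A' A) (dayMul f p))
    (fun c p => by rw [dayMul_res_right, Hat.app_res])

theorem leftApply_actLeft (F : PshModule (Hat V) B) {X : V} {A' A : B}
    (f : (A' ⟶[Hat V] A).functor.obj (op X)) {Z : V} (p : (F.obj A).functor.obj (op Z)) :
    leftApply (actLeft F f) p = Hat.app (F.act A' A) (dayMul f p) := by
  unfold actLeft
  exact leftApply_ofLeft (P := F.obj A) (Q := F.obj A')
    (fun _ p => Hat.app (F.act A' A) (dayMul f p))
    (fun c p => by rw [dayMul_res_right, Hat.app_res]) p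

theorem actLeft_reindex (F : PshModule (Hat V) B) {X Y : V} {A' A : B} (a : Y ⟶ X)
    (f : (A' ⟶[Hat V] A).functor.obj (op X)) :
    actLeft F ((A' ⟶[Hat V] A).res a f) = (leftPart (hatBigraded V)).reindex a (actLeft F f) :=
  left_ext fun _ p => by
    rw [leftApply_actLeft, leftApply_reindex, leftApply_actLeft, dayMul_res_left, Hat.app_res]

theorem actLeft_comp (F : PshModule (Hat V) B) {X Y : V} {A'' A' A : B}
    (g : (A'' ⟶[Hat V] A').functor.obj (op Y)) (f : (A' ⟶[Hat V] A).functor.obj (op X)) :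
    actLeft F (Hat.app (eComp (Hat V) A'' A' A) (dayMul g f)) =
      (leftPart (hatBigraded V)).comp (actLeft F g) (actLeft F f) :=
  left_ext fun _ p => by
    rw [leftApply_actLeft, leftApply_comp, leftApply_actLeft, leftApply_actLeft, app_act_comp]

theorem actLeft_id (F : PshModule (Hat V) B) (A : B) :
    actLeft F (Hat.app (eId (Hat V) A) (dayUnit V)) = (leftPart (hatBigraded V)).id (F.obj A) :=
  left_ext fun _ p => by
    rw [leftApply_actLeft, leftApply_id, app_act_id]

/-- The left graded functor `B° ⟶ V̂` corresponding to a module `𝕀 -|-> B`. -/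
noncomputable def toGradedFunctor (F : PshModule (Hat V) B) :
    GradedFunctor (formalOp (ofEnriched (V := V) B)) (leftPart (hatBigraded V)) where
  obj A := F.obj A
  map f := actLeft F f
  map_reindex a f := actLeft_reindex F a f
  map_comp g f := actLeft_comp F g f
  map_id A := actLeft_id F A

/-- The graded morphism `p ↦ ε (p, φ)` determined by an element `φ` of the hom-object `G^F`. -/
noncomputable def evalRight {F G : PshModule (Hat V) B} {X' : Vᴹᵒᵖ}
    (φ : (F ⟶[Hat V] G).functor.obj (op X'.unmop)) (A : B) :
    (rightPart (hatBigraded V)).Hom X' (F.obj A) (G.obj A) :=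
  ofRight (P := F.obj A) (Q := G.obj A)
    (fun _ p => Hat.app ((dayRightLifting F G).ε A) (dayMul p φ))
    (fun c p => by rw [dayMul_res_left, Hat.app_res])

theorem rightApply_evalRight {F G : PshModule (Hat V) B} {X' : Vᴹᵒᵖ}
    (φ : (F ⟶[Hat V] G).functor.obj (op X'.unmop)) (A : B) {Z : V}
    (p : (F.obj A).functor.obj (op Z)) :
    rightApply (evalRight φ A) p = Hat.app ((dayRightLifting F G).ε A) (dayMul p φ) := by
  unfold evalRight
  exact rightApply_ofRight (P := F.obj A) (Q := G.obj A)
    (fun _ p => Hat.app ((dayRightLifting F G).ε A) (dayMul p φ))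
    (fun c p => by rw [dayMul_res_left, Hat.app_res]) p

theorem evalRight_square {F G : PshModule (Hat V) B} {X : V} {X' : Vᴹᵒᵖ}
    (φ : (F ⟶[Hat V] G).functor.obj (op X'.unmop)) {A' A : B}
    (f : (A' ⟶[Hat V] A).functor.obj (op X)) :
    IsBigradedSquare (hatBigraded V) (actLeft F f) (actLeft G f) (evalRight φ A)
      (evalRight φ A') :=
  (isBigradedSquare_hat_iff _ _ _ _).2 fun Z p => by
    rw [leftApply_actLeft, leftApply_actLeft, rightApply_evalRight, rightApply_evalRight]
    refine Eq.trans ?_ (congrArg _ (app_isTrans (dayRightLifting F G).isTrans f p φ).symm)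
    rw [Hat.res_res, Iso.inv_hom_id, Hat.res_id]

theorem evalRight_reindex {F G : PshModule (Hat V) B} {X' Y' : Vᴹᵒᵖ} (a : Y' ⟶ X')
    (φ : (F ⟶[Hat V] G).functor.obj (op X'.unmop)) (A : B) :
    evalRight ((F ⟶[Hat V] G).res a.unmop φ) A =
      (rightPart (hatBigraded V)).reindex a (evalRight φ A) :=
  right_ext fun _ p => by
    rw [rightApply_evalRight, rightApply_reindex, rightApply_evalRight, ← Hat.app_res]
    exact congrArg (Hat.app _) (dayMul_res_right _ _ _)

theorem evalRight_comp {F G H : PshModule (Hat V) B} {X' Y' : Vᴹᵒᵖ}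
    (ψ : (G ⟶[Hat V] H).functor.obj (op Y'.unmop)) (φ : (F ⟶[Hat V] G).functor.obj (op X'.unmop))
    (A : B) :
    evalRight (X' := Y' ⊗ X') (Hat.app (eComp (Hat V) F G H) (dayMul φ ψ)) A =
      (rightPart (hatBigraded V)).comp (evalRight ψ A) (evalRight φ A) :=
  right_ext fun _ p => by
    rw [rightApply_evalRight, rightApply_comp, rightApply_evalRight, rightApply_evalRight]
    exact app_ε_comp dayRightLifting A p φ ψ

theorem evalRight_id (F : PshModule (Hat V) B) (A : B) :
    evalRight (X' := 𝟙_ Vᴹᵒᵖ) (Hat.app (eId (Hat V) F) (dayUnit V)) A =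
      (rightPart (hatBigraded V)).id (F.obj A) :=
  right_ext fun _ p => by
    rw [rightApply_evalRight, rightApply_id]
    exact app_ε_id dayRightLifting A p

/-- The comparison functor from Street's presheaf `V̂`-category to the graded functor category,
given on objects by the usual correspondence between modules `𝕀 -|-> B` and left graded functors
`B° ⟶ V̂`, and on graded morphisms by evaluation. -/
noncomputable def comparison (B : Type u) [EnrichedCategory (Hat V) B] :
    GradedFunctor (ofEnriched (V := V) (PshModule (Hat V) B))
      (functorCat (formalOp (ofEnriched (V := V) B)) (hatBigraded V)) where
  obj F := toGradedFunctor F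
  map φ := ⟨fun A => evalRight φ A, fun f => evalRight_square φ f⟩
  map_reindex a φ := Subtype.ext (funext fun A => evalRight_reindex a φ A)
  map_comp ψ φ := Subtype.ext (funext fun A => evalRight_comp ψ φ A)
  map_id F := Subtype.ext (funext fun A => evalRight_id F A)

end Comparison

/-- The `V`-graded Yoneda embedding: the transpose of the hom bifunctor `B(-, ?)`. -/
noncomputable def yonedaEmbedding (B : RightGradedCat.{u, u} V) :
    GradedFunctor B (functorCat (formalOp B) (hatBigraded V)) :=
  (homBifunctor B).transpose

/-- The graded bifunctor `[B°, V̂](y -, ?) : B°, [B°, V̂] ⟶ V̂`. -/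
noncomputable def yonedaHom (B : RightGradedCat.{u, u} V) :
    GradedBifunctor (formalOp B) (functorCat (formalOp B) (hatBigraded V)) (hatBigraded V) :=
  (homBifunctor (functorCat (formalOp B) (hatBigraded V))).precompLeft (yonedaEmbedding B).formalOp

end Presheaves
end VGraded

open VGraded

/-! Everything is tested on elements. A graded morphism of `V̂` of grade `(X, I)`, `(I, X')` or `(I,
I)` is a natural family of maps `P Z → Q (X ⊗ Z)`, `P Z → Q (Z ⊗ X')` or `P Z → Q Z`, recovered by
`leftApply`, `rightApply` and `unitApply`. On the other side, a morphism out of a Day tensor product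
is determined by its values on the elements `dayMul p q`. Each equation of graded morphisms thus
becomes an equation between elements of a presheaf, up to restriction along a coherence isomorphism
of `V`.

Comparison with Street's presheaves. An action `B(A', A) ⊗ FA ⟶ FA'` is, by the universal property
of Day convolution, a natural family `f, p ↦ f · p`; its unit and associativity laws say exactly
that `f ↦ (p ↦ f · p)` is a left graded functor on `B°`. This gives the bijection on objects. The
elements of the right lifting of `G` along `F` at `X` are natural families `FA Z → GA (Z ⊗ X)`
commuting with the actions, and commuting with the action of `f` is the bigraded square at `f`
(`isBigradedSquare_hat_iff`). So the comparison is fully faithful (`comparison_fullyFaithful`), and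
a fully faithful functor bijective on objects is an isomorphism
(`GradedFunctor.FullyFaithful.isIso`). Street's embedding is the transpose of composition, so under
the comparison it becomes postcomposition, which is how `yonedaEmbedding` acts.

Yoneda lemma. An element `x` of `F b` gives `f ↦ (Ff)(x)`, whose squares hold by functoriality of
`F`. Evaluation at the identity inverts this, because the square of `φ` at `f`, applied to the
identity, forces `φ f = (Ff)(φ id)`; hence `yonedaExtend_bijective`. Full faithfulness of `y` is the
case of a representable `F`, where the element `g` is extended to postcomposition with `g`.
Naturality in `b` is functoriality of `F`, and naturality in `F` is the square condition on the
morphisms of the functor category. The inverse transformation then comes for free, since pointwise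
inverses of a natural family are natural. -/

namespace VGraded

/-! ### Isomorphisms of graded categories and transport along equalities of objects. -/

section Isomorphisms

variable {V : Type u} [Category.{u} V] [MonoidalCategory V]

/-- Transport of a graded morphism along equalities of its source and target. -/
def GradedCat.castHom (C : GradedCat.{u, w} V) {X : V} {A A' B B' : C.Obj} (hA : A = A')
    (hB : B = B') (f : C.Hom X A B) : C.Hom X A' B' :=
  hA ▸ hB ▸ f

theorem GradedCat.castHom_reindex (C : GradedCat.{u, w} V) {X Y : V} {A A' B B' : C.Obj}
    (hA : A = A') (hB : B = B') (a : Y ⟶ X) (f : C.Hom X A B) :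
    C.castHom hA hB (C.reindex a f) = C.reindex a (C.castHom hA hB f) := by
  subst hA hB
  rfl

theorem GradedCat.castHom_comp (C : GradedCat.{u, w} V) {X Y : V} {A A' B B' D D' : C.Obj}
    (hA : A = A') (hB : B = B') (hD : D = D') (g : C.Hom Y B D) (f : C.Hom X A B) :
    C.castHom hA hD (C.comp g f) = C.comp (C.castHom hB hD g) (C.castHom hA hB f) := by
  subst hA hB hD
  rfl

theorem GradedCat.castHom_id (C : GradedCat.{u, w} V) {A A' : C.Obj} (h : A = A') :
    C.castHom h h (C.id A) = C.id A' := by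
  subst h
  rfl

theorem GradedCat.castHom_castHom_symm (C : GradedCat.{u, w} V) {X : V} {A A' B B' : C.Obj}
    (hA : A = A') (hB : B = B') (f : C.Hom X A' B') :
    C.castHom hA hB (C.castHom hA.symm hB.symm f) = f := by
  subst hA hB
  rfl

theorem GradedFunctor.map_castHom {C : GradedCat.{u, w₁} V} {D : GradedCat.{u, w₂} V}
    (F : GradedFunctor C D) {X : V} {A A' B B' : C.Obj} (hA : A = A') (hB : B = B')
    (f : C.Hom X A B) :
    F.map (C.castHom hA hB f) =
      D.castHom (congrArg F.obj hA) (congrArg F.obj hB) (F.map f) := by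
  subst hA hB
  rfl

/-- Explicit transport replaces the heterogeneous equality of the action on morphisms. When the
object maps agree definitionally, the transport disappears and only an ordinary equation of graded
morphisms remains. -/
theorem GradedFunctor.ext_castHom {C : GradedCat.{u, w₁} V} {D : GradedCat.{u, w₂} V}
    {F G : GradedFunctor C D} (hobj : ∀ A : C.Obj, F.obj A = G.obj A)
    (hmap : ∀ {X : V} {A B : C.Obj} (f : C.Hom X A B),
      D.castHom (hobj A) (hobj B) (F.map f) = G.map f) : F = G := by
  obtain ⟨obj, map, h₁, h₂, h₃⟩ := F
  obtain ⟨obj', map', h₁', h₂', h₃'⟩ := G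
  obtain rfl : obj = obj' := funext hobj
  obtain rfl : @map = @map' := by
    funext X A B f
    exact hmap f
  rfl

/-- A fully faithful graded functor that is bijective on objects is an isomorphism. -/
theorem GradedFunctor.FullyFaithful.isIso {C : GradedCat.{u, w₁} V} {D : GradedCat.{u, w₂} V}
    {F : GradedFunctor C D} (hF : F.FullyFaithful) (hobj : Function.Bijective F.obj) :
    F.IsIso := by
  obtain ⟨g, hl, hr⟩ := Function.bijective_iff_has_inverse.1 hobj
  -- `F.obj (g A)` equals `A` only propositionally, so the preimage under `F` is taken of the
  -- transported morphism. The functor laws for the chosen preimages then follow from injectivity of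
  -- `F.map`.
  have hsurj : ∀ {X : V} {A B : D.Obj} (f : D.Hom X A B),
      ∃ f' : C.Hom X (g A) (g B), F.map f' = D.castHom (hr A).symm (hr B).symm f :=
    fun f => (hF _ _ _).2 _
  choose m hm using @hsurj
  refine ⟨{ obj := g, map := m, map_reindex := ?_, map_comp := ?_, map_id := ?_ }, ?_, ?_⟩
  · intro X Y A B a f
    apply (hF _ _ _).1
    rw [hm, F.map_reindex, hm, D.castHom_reindex]
  · intro X Y A B E h f
    apply (hF _ _ _).1
    rw [hm, F.map_comp, hm, hm, D.castHom_comp]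
  · intro A
    apply (hF _ _ _).1
    rw [hm, F.map_id, D.castHom_id]
  -- The equation is tested after applying `F`, which carries transport in the source to transport
  -- in the target, where it cancels the one built into `m`.
  · refine ext_castHom hl fun {X A B} f => (hF _ _ _).1 ?_
    refine (F.map_castHom (hl A) (hl B) _).trans ?_
    exact (congrArg _ (hm (F.map f))).trans
      (D.castHom_castHom_symm (congrArg F.obj (hl A)) (congrArg F.obj (hl B)) (F.map f))
  · refine ext_castHom hr fun {X A B} f => ?_
    exact (congrArg _ (hm f)).trans (D.castHom_castHom_symm (hr A) (hr B) f)

end Isomorphisms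

/-! ### Graded morphisms of `V̂` of unit grade, and graded naturality on elements. -/

section Units

variable {V : Type u} [Category.{u} V] [MonoidalCategory V]

/-- The graded morphism with grade `(I, I)` given by a natural family `P Z → Q Z`. -/
def ofUnit {P Q : Hat V} (m : ∀ Z : V, P.functor.obj (op Z) → Q.functor.obj (op Z))
    (hm : ∀ {Z Z' : V} (c : Z' ⟶ Z) (p : P.functor.obj (op Z)),
      m Z' (P.res c p) = Q.res c (m Z p)) : (hatBigraded V).Hom (𝟙_ (V × Vᴹᵒᵖ)) P Q :=
  show HatHom (𝟙_ V) (𝟙_ V) P Q from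
  { app Z p := Q.res ((ρ_ (𝟙_ V ⊗ Z)).hom ≫ (λ_ Z).hom) (m Z p)
    naturality c p := by
      rw [hm, Q.res_res, Q.res_res]
      exact Q.res_congr (by simp) _ }

theorem unitApply_ofUnit {P Q : Hat V}
    (m : ∀ Z : V, P.functor.obj (op Z) → Q.functor.obj (op Z))
    (hm : ∀ {Z Z' : V} (c : Z' ⟶ Z) (p : P.functor.obj (op Z)),
      m Z' (P.res c p) = Q.res c (m Z p)) {Z : V} (p : P.functor.obj (op Z)) :
    unitApply (ofUnit m hm) p = m Z p := by
  refine (Q.res_res _ _ _).trans ?_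
  simp

theorem unit_ext {P Q : Hat V} {φ ψ : (hatBigraded V).Hom (𝟙_ (V × Vᴹᵒᵖ)) P Q}
    (h : ∀ (Z : V) (p : P.functor.obj (op Z)), unitApply φ p = unitApply ψ p) : φ = ψ :=
  HatHom.ext (funext fun Z => funext fun p =>
    (Q.res_bijective ((λ_ Z).inv ≫ (ρ_ (𝟙_ V ⊗ Z)).inv) ((ρ_ (𝟙_ V ⊗ Z)).hom ≫ (λ_ Z).hom)
      (by simp) (by simp)).1 (h Z p))

/-- A morphism of grade `(I, I)` is also one of grade `(X, I)` with `X = I`; the two descriptions on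
elements differ by a unitor. This lets the composition formulas for one-sided grades be used with
the components of a transformation. -/
theorem leftApply_unit {P Q : Hat V} (φ : (hatBigraded V).Hom (𝟙_ (V × Vᴹᵒᵖ)) P Q) {Z : V}
    (p : P.functor.obj (op Z)) :
    leftApply (X := 𝟙_ V) φ p = Q.res (λ_ Z).hom (unitApply φ p) := by
  refine Eq.trans (Q.res_congr ?_ _) (Q.res_res _ _ _).symm
  simp

theorem rightApply_unit {P Q : Hat V} (φ : (hatBigraded V).Hom (𝟙_ (V × Vᴹᵒᵖ)) P Q) {Z : V}
    (p : P.functor.obj (op Z)) :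
    rightApply (X' := 𝟙_ Vᴹᵒᵖ) φ p = Q.res (ρ_ Z).hom (unitApply φ p) := by
  refine Eq.trans (Q.res_congr ?_ _) (Q.res_res _ _ _).symm
  change (λ_ Z).inv ▷ 𝟙_ V = _
  simp

theorem unitApply_comp₀ {P Q R : Hat V} (ψ : (hatBigraded V).Hom (𝟙_ (V × Vᴹᵒᵖ)) Q R)
    (φ : (hatBigraded V).Hom (𝟙_ (V × Vᴹᵒᵖ)) P Q) {Z : V} (p : P.functor.obj (op Z)) :
    unitApply ((hatBigraded V).comp₀ ψ φ) p = unitApply ψ (unitApply φ p) := by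
  -- Naturality of `ψ` moves the coherence isomorphism hidden in `unitApply φ p` outside, so that
  -- both sides restrict the same element of `R`.
  have h : unitApply ψ (unitApply φ p) =
      R.res ((λ_ Z).inv ≫ (ρ_ (𝟙_ V ⊗ Z)).inv) (R.res _
        (HatHom.app ψ _ (HatHom.app φ Z p))) :=
    congrArg _ (HatHom.naturality ψ ((λ_ Z).inv ≫ (ρ_ (𝟙_ V ⊗ Z)).inv) (HatHom.app φ Z p))
  rw [h]
  refine (R.res_res _ _ _).trans ((R.res_res _ _ _).trans
    (Eq.trans (R.res_congr ?_ _) (R.res_res _ _ _).symm))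
  change (((λ_ Z).inv ≫ (ρ_ (𝟙_ V ⊗ Z)).inv) ≫ (((λ_ (𝟙_ V)).inv ▷ Z) ⊗ₘ (ρ_ (𝟙_ V)).inv)) ≫
    sandwichComp (𝟙_ V) (𝟙_ V) (𝟙_ V) (𝟙_ V) Z = ((λ_ Z).inv ≫ (ρ_ (𝟙_ V ⊗ Z)).inv) ≫
      ((𝟙_ V) ◁ ((λ_ Z).inv ≫ (ρ_ (𝟙_ V ⊗ Z)).inv)) ▷ (𝟙_ V)
  unfold sandwichComp
  monoidal

theorem unitApply_id (P : Hat V) {Z : V} (p : P.functor.obj (op Z)) :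
    unitApply ((hatBigraded V).id P) p = p := by
  refine (P.res_res _ _ _).trans ?_
  simp

theorem unitApply_res {P Q : Hat V} (φ : (hatBigraded V).Hom (𝟙_ (V × Vᴹᵒᵖ)) P Q) {Z Z' : V}
    (c : Z' ⟶ Z) (p : P.functor.obj (op Z)) :
    unitApply φ (P.res c p) = Q.res c (unitApply φ p) := by
  refine (congrArg (Q.res _) (HatHom.naturality φ c p)).trans ?_
  refine (Q.res_res _ _ _).trans (Eq.trans (Q.res_congr ?_ _) (Q.res_res _ _ _).symm)
  change ((λ_ Z').inv ≫ (ρ_ (𝟙_ V ⊗ Z')).inv) ≫ (((𝟙_ V) ◁ c) ▷ (𝟙_ V)) =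
    c ≫ (λ_ Z).inv ≫ (ρ_ (𝟙_ V ⊗ Z)).inv
  simp

/-- This is one side of the graded naturality condition evaluated on elements: the unitor in that
condition cancels the associator and unitor produced by composing with a morphism of unit grade. The
next three lemmas treat the other side and the right graded case. -/
theorem leftApply_comp_unit {X : V} {P Q R : Hat V}
    (δ : (hatBigraded V).Hom (𝟙_ (V × Vᴹᵒᵖ)) Q R)
    (f : (leftPart (hatBigraded V)).Hom X P Q) {Z : V} (p : P.functor.obj (op Z)) :
    leftApply ((leftPart (hatBigraded V)).reindex (λ_ X).inv
      ((leftPart (hatBigraded V)).comp (X := X) (Y := 𝟙_ V) δ f)) p =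
        unitApply δ (leftApply f p) := by
  refine (leftApply_reindex _ _ p).trans ((congrArg (R.res _) ((leftApply_comp (Y := 𝟙_ V) δ f
    p).trans (congrArg (R.res _) (leftApply_unit δ _)))).trans ?_)
  refine (congrArg _ (R.res_res _ _ _)).trans ((R.res_res _ _ _).trans
    ((R.res_congr ?_ _).trans (R.res_id _)))
  simp

theorem leftApply_unit_comp {X : V} {P Q R : Hat V}
    (δ : (hatBigraded V).Hom (𝟙_ (V × Vᴹᵒᵖ)) P Q)
    (g : (leftPart (hatBigraded V)).Hom X Q R) {Z : V} (p : P.functor.obj (op Z)) :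
    leftApply ((leftPart (hatBigraded V)).reindex (ρ_ X).inv
      ((leftPart (hatBigraded V)).comp (X := 𝟙_ V) (Y := X) g δ)) p =
        leftApply g (unitApply δ p) := by
  refine (leftApply_reindex _ _ p).trans ((congrArg (R.res _) ((leftApply_comp (X := 𝟙_ V) g δ
    p).trans (congrArg (R.res _) ((congrArg (leftApply g) (leftApply_unit δ p)).trans
      (leftApply_res g _ _))))).trans ?_)
  refine (congrArg _ (R.res_res _ _ _)).trans ((R.res_res _ _ _).trans
    ((R.res_congr ?_ _).trans (R.res_id _)))
  simp

theorem rightApply_comp_unit {X : Vᴹᵒᵖ} {P Q R : Hat V}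
    (δ : (hatBigraded V).Hom (𝟙_ (V × Vᴹᵒᵖ)) Q R)
    (f : (rightPart (hatBigraded V)).Hom X P Q) {Z : V} (p : P.functor.obj (op Z)) :
    rightApply ((rightPart (hatBigraded V)).reindex (λ_ X).inv
      ((rightPart (hatBigraded V)).comp (X := X) (Y := 𝟙_ Vᴹᵒᵖ) δ f)) p =
        unitApply δ (rightApply f p) := by
  refine (rightApply_reindex _ _ p).trans ((congrArg (R.res _) ((rightApply_comp (Y := 𝟙_ Vᴹᵒᵖ)
    δ f p).trans (congrArg (R.res _) (rightApply_unit δ _)))).trans ?_)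
  refine (congrArg _ (R.res_res _ _ _)).trans ((R.res_res _ _ _).trans
    ((R.res_congr ?_ _).trans (R.res_id _)))
  change Z ◁ (ρ_ X.unmop).inv ≫ (α_ Z X.unmop (𝟙_ V)).inv ≫ (ρ_ (Z ⊗ X.unmop)).hom = 𝟙 _
  simp

theorem rightApply_unit_comp {X : Vᴹᵒᵖ} {P Q R : Hat V}
    (δ : (hatBigraded V).Hom (𝟙_ (V × Vᴹᵒᵖ)) P Q)
    (g : (rightPart (hatBigraded V)).Hom X Q R) {Z : V} (p : P.functor.obj (op Z)) :
    rightApply ((rightPart (hatBigraded V)).reindex (ρ_ X).inv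
      ((rightPart (hatBigraded V)).comp (X := 𝟙_ Vᴹᵒᵖ) (Y := X) g δ)) p =
        rightApply g (unitApply δ p) := by
  refine (rightApply_reindex _ _ p).trans ((congrArg (R.res _) ((rightApply_comp (X := 𝟙_ Vᴹᵒᵖ)
    g δ p).trans (congrArg (R.res _) ((congrArg (rightApply g) (rightApply_unit δ p)).trans
      (rightApply_res g _ _))))).trans ?_)
  refine (congrArg _ (R.res_res _ _ _)).trans ((R.res_res _ _ _).trans
    ((R.res_congr ?_ _).trans (R.res_id _)))
  change Z ◁ (λ_ X.unmop).inv ≫ (α_ Z (𝟙_ V) X.unmop).inv ≫ (ρ_ Z).hom ▷ X.unmop = 𝟙 _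
  simp

/-- On elements all coherence isomorphisms in `NaturalAt` cancel, leaving a commutative square of
maps of sets. -/
theorem naturalAt_left_iff {C : GradedCat.{u, w} V}
    {F G : GradedFunctor C (leftPart (hatBigraded V))} {X : V} {A B : C.Obj} (f : C.Hom X A B)
    (δA : (hatBigraded V).Hom (𝟙_ (V × Vᴹᵒᵖ)) (F.obj A) (G.obj A))
    (δB : (hatBigraded V).Hom (𝟙_ (V × Vᴹᵒᵖ)) (F.obj B) (G.obj B)) :
    GradedFunctor.NaturalAt F G f δA δB ↔
      ∀ (Z : V) (p : (F.obj A).functor.obj (op Z)),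
        unitApply δB (leftApply (F.map f) p) = leftApply (G.map f) (unitApply δA p) := by
  constructor
  · intro h Z p
    exact (leftApply_comp_unit δB (F.map f) p).symm.trans
      ((congrArg (fun t => leftApply t p) h).trans (leftApply_unit_comp δA (G.map f) p))
  · intro h
    refine left_ext fun Z p => ?_
    exact (leftApply_comp_unit δB (F.map f) p).trans ((h Z p).trans
      (leftApply_unit_comp δA (G.map f) p).symm)

theorem naturalAt_right_iff {C : RightGradedCat.{u, w} V}
    {F G : GradedFunctor C (rightPart (hatBigraded V))} {X : Vᴹᵒᵖ} {A B : C.Obj}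
    (f : C.Hom X A B)
    (δA : (hatBigraded V).Hom (𝟙_ (V × Vᴹᵒᵖ)) (F.obj A) (G.obj A))
    (δB : (hatBigraded V).Hom (𝟙_ (V × Vᴹᵒᵖ)) (F.obj B) (G.obj B)) :
    GradedFunctor.NaturalAt F G f δA δB ↔
      ∀ (Z : V) (p : (F.obj A).functor.obj (op Z)),
        unitApply δB (rightApply (F.map f) p) = rightApply (G.map f) (unitApply δA p) := by
  constructor
  · intro h Z p
    exact (rightApply_comp_unit δB (F.map f) p).symm.trans
      ((congrArg (fun t => rightApply t p) h).trans (rightApply_unit_comp δA (G.map f) p))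
  · intro h
    refine right_ext fun Z p => ?_
    exact (rightApply_comp_unit δB (F.map f) p).trans ((h Z p).trans
      (rightApply_unit_comp δA (G.map f) p).symm)

end Units

/-! ### Modules as graded functors, and Street's Yoneda embedding under the comparison. -/

section ComparisonIso

variable {V : Type u} [Category.{u} V] [MonoidalCategory V]
  {B : Type u} [EnrichedCategory (Hat V) B]

theorem app_leftUnitor_inv {P : Hat V} {X : V} (p : P.functor.obj (op X)) :
    Hat.app (λ_ P).inv p = (𝟙_ (Hat V) ⊗ P).res (λ_ X).inv (dayMul (dayUnit V) p) := by
  have h : Hat.app (λ_ P).inv (Hat.app (λ_ P).hom (dayMul (dayUnit V) p)) =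
      dayMul (dayUnit V) p := by
    rw [← Hat.app_comp, Iso.hom_inv_id, Hat.app_id]
  rw [← h, app_leftUnitor, ← Hat.app_res, Hat.res_res, Iso.inv_hom_id, Hat.res_id]

/-- The left unitor is invertible and its inverse sends `p` to a restriction of `dayMul (dayUnit V)
p`, so these elements determine a morphism out of `𝟙_ ⊗ P`. It reduces the unit law of a module to
the action of the identity element. -/
theorem dayUnit_hom_ext {P R : Hat V} {α β : 𝟙_ (Hat V) ⊗ P ⟶ R}
    (h : ∀ (X : V) (p : P.functor.obj (op X)),
      Hat.app α (dayMul (dayUnit V) p) = Hat.app β (dayMul (dayUnit V) p)) : α = β := by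
  rw [← cancel_epi (λ_ P).inv]
  refine Hat.hom_ext fun X p => ?_
  rw [Hat.app_comp, Hat.app_comp, app_leftUnitor_inv, Hat.app_res, Hat.app_res, h]

/-- The module on `B` given by an action on elements. -/
noncomputable def PshModule.ofAction (P : B → Hat V)
    (m : ∀ (A' A : B) (X Z : V), (A' ⟶[Hat V] A).functor.obj (op X) →
      (P A).functor.obj (op Z) → (P A').functor.obj (op (X ⊗ Z)))
    (m_res : ∀ (A' A : B) {X X' Z Z' : V} (a : X' ⟶ X) (b : Z' ⟶ Z)
      (f : (A' ⟶[Hat V] A).functor.obj (op X)) (p : (P A).functor.obj (op Z)),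
      m A' A X' Z' ((A' ⟶[Hat V] A).res a f) ((P A).res b p) =
        (P A').res (a ⊗ₘ b) (m A' A X Z f p))
    (m_id : ∀ (A : B) (Z : V) (p : (P A).functor.obj (op Z)),
      m A A (𝟙_ V) Z (Hat.app (eId (Hat V) A) (dayUnit V)) p = (P A).res (λ_ Z).hom p)
    (m_comp : ∀ (A'' A' A : B) (X Y Z : V) (g : (A'' ⟶[Hat V] A').functor.obj (op X))
      (f : (A' ⟶[Hat V] A).functor.obj (op Y)) (p : (P A).functor.obj (op Z)),
      m A'' A (X ⊗ Y) Z (Hat.app (eComp (Hat V) A'' A' A) (dayMul g f)) p =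
        (P A'').res (α_ X Y Z).hom (m A'' A' X (Y ⊗ Z) g (m A' A Y Z f p))) :
    PshModule (Hat V) B where
  obj := P
  act A' A := dayDesc (m A' A) (m_res A' A)
  id_act A := dayUnit_hom_ext fun X p => by
    rw [Hat.app_comp, app_whiskerRight, app_leftUnitor, app_dayDesc, m_id]
  comp_act A'' A' A := dayMul_hom_ext₃ fun X Y Z g f p => by
    simp only [Hat.app_comp, app_associator, app_whiskerRight, Hat.app_res, app_whiskerLeft,
      app_dayDesc, m_comp]

/-- Joint naturality in `f` and `p`, the condition under which the action of a graded functor on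
elements descends to the Day tensor product. -/
theorem leftApply_map_res {E : RightGradedCat.{u, w} V}
    (F : GradedFunctor (formalOp E) (leftPart (hatBigraded V))) {A A' : E.Obj} {X X' Z Z' : V}
    (a : X' ⟶ X) (b : Z' ⟶ Z) (f : (homPresheaf E A' A).functor.obj (op X))
    (p : (F.obj A).functor.obj (op Z)) :
    leftApply (F.map (X := X') (A := A) (B := A') ((homPresheaf E A' A).res a f))
      (Hat.res (F.obj A) b p) =
      Hat.res (F.obj A') (a ⊗ₘ b) (leftApply (F.map (X := X) (A := A) (B := A') f) p) := by
  refine (leftApply_res _ b p).trans ((congrArg _ ((congrArg (fun t => leftApply t p)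
    (F.map_reindex (A := A) (B := A') a f)).trans (leftApply_reindex a _ p))).trans ?_)
  refine (Hat.res_res _ _ _ _).trans (Hat.res_congr _ ?_ _)
  rw [MonoidalCategory.tensorHom_def']

/-- The module corresponding to a left graded functor `B° ⟶ V̂`. -/
noncomputable def ofGradedFunctor
    (F : GradedFunctor (formalOp (ofEnriched (V := V) B)) (leftPart (hatBigraded V))) :
    PshModule (Hat V) B :=
  PshModule.ofAction (fun A => F.obj A)
    (fun A' A X _ f p => leftApply (F.map (X := X) (A := A) (B := A') f) p)
    (fun _ _ _ _ _ _ a b f p => leftApply_map_res F a b f p)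
    (fun A _ p => (congrArg (fun t => leftApply t p) (F.map_id A)).trans (leftApply_id _ p))
    (fun A'' A' A X Y _ g f p => (congrArg (fun t => leftApply t p)
      (F.map_comp (X := Y) (Y := X) (A := A) (B := A') (E := A'') g f)).trans
        (leftApply_comp _ _ p))

theorem app_ofGradedFunctor_act
    (F : GradedFunctor (formalOp (ofEnriched (V := V) B)) (leftPart (hatBigraded V))) {A' A : B}
    {X Z : V} (f : (A' ⟶[Hat V] A).functor.obj (op X))
    (p : ((ofGradedFunctor F).obj A).functor.obj (op Z)) :
    Hat.app ((ofGradedFunctor F).act A' A) (dayMul f p) =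
      leftApply (F.map (X := X) (A := A) (B := A') f) p :=
  app_dayDesc (P := A' ⟶[Hat V] A) (Q := F.obj A) (R := F.obj A')
    (fun X _ f p => leftApply (F.map (X := X) (A := A) (B := A') f) p)
    (fun a b f p => leftApply_map_res F a b f p) f p

theorem ofGradedFunctor_toGradedFunctor (F : PshModule (Hat V) B) :
    ofGradedFunctor (toGradedFunctor F) = F := by
  -- The object families coincide definitionally, so only the action morphisms have to be compared,
  -- and these are determined by the elements `dayMul f p`.
  refine PshModule.ext rfl (heq_of_eq (funext fun A' => funext fun A =>
    dayMul_hom_ext fun X Z f p => ?_))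
  exact (app_ofGradedFunctor_act (toGradedFunctor F) f p).trans (leftApply_actLeft F f p)

theorem toGradedFunctor_ofGradedFunctor
    (F : GradedFunctor (formalOp (ofEnriched (V := V) B)) (leftPart (hatBigraded V))) :
    toGradedFunctor (ofGradedFunctor F) = F := by
  refine GradedFunctor.ext_castHom (fun _ => rfl) fun {X A A'} f => left_ext fun Z p => ?_
  exact (leftApply_actLeft (ofGradedFunctor F) f p).trans (app_ofGradedFunctor_act F f p)

/-- An element of Street's hom-object is by construction a `LiftingElement`, and evaluating it
through the universal transformation returns the family itself. -/
theorem rightApply_evalRight_eq_app {F G : PshModule (Hat V) B} {X' : Vᴹᵒᵖ}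
    (φ : LiftingElement F G X'.unmop) (A : B) {Z : V} (p : (F.obj A).functor.obj (op Z)) :
    rightApply (evalRight (F := F) (G := G) φ A) p = φ.app A Z p :=
  (rightApply_evalRight (F := F) (G := G) φ A p).trans (app_liftingEval p φ)

/-- Both sides consist of the same data, natural families `FA Z → GA (Z ⊗ X)`, under the same
condition: compatibility with the action of `f` is the bigraded square at `f`, up to moving an
associator across the equation. -/
theorem comparison_fullyFaithful : (comparison (V := V) B).FullyFaithful := by
  intro X' F G
  constructor
  · intro φ ψ h
    refine LiftingElement.ext (funext fun A => funext fun Z => funext fun p => ?_)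
    rw [← rightApply_evalRight_eq_app φ A p, ← rightApply_evalRight_eq_app ψ A p]
    exact congrArg (fun t => rightApply (t.1 A) p) h
  · intro φ
    let ψ : LiftingElement F G X'.unmop :=
      { app A Z p := rightApply (φ.1 A) p
        naturality A Z Z' c p := rightApply_res (φ.1 A) c p
        act A' A Y Z f p := by
          -- The square is stated with the inverse associator on the side of `φ A'`; restricting
          -- along the associator turns it into the condition required of a `LiftingElement`.
          have h := (isBigradedSquare_hat_iff _ _ _ _).1
            (φ.2 (X := Y) (a := A) (b := A') f) Z p
          have h₁ := leftApply_actLeft G f (rightApply (φ.1 A) p)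
          have h₂ := leftApply_actLeft F f p
          refine (congrArg (rightApply (φ.1 A')) h₂.symm).trans ?_
          refine Eq.trans ?_ (congrArg _ (h.symm.trans h₁))
          refine Eq.trans ?_ (Hat.res_res _ _ _ _).symm
          exact ((Hat.res_congr _ (Iso.hom_inv_id _) _).trans (Hat.res_id _ _)).symm }
    exact ⟨ψ, Subtype.ext (funext fun A => right_ext fun Z p =>
      rightApply_evalRight_eq_app ψ A p)⟩

theorem comparison_isIso : (comparison (V := V) B).IsIso :=
  comparison_fullyFaithful.isIso (Function.bijective_iff_has_inverse.2
    ⟨ofGradedFunctor, ofGradedFunctor_toGradedFunctor, toGradedFunctor_ofGradedFunctor⟩)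

/-- The objects compared later are graded functors that are equal but not definitionally so, while
their values at each `a` do agree definitionally. Taking components therefore makes the transport
trivial. -/
theorem functorCat_castHom_val {A : GradedCat.{u, u} V} {C : BigradedCat.{u, w} V V} {X : Vᴹᵒᵖ}
    {F F' G G' : (functorCat A C).Obj} (hF : F = F') (hG : G = G')
    (φ : (functorCat A C).Hom X F G) (a : A.Obj) :
    ((functorCat A C).castHom hF hG φ).1 a = (rightPart C).castHom
      (congrArg (fun H : GradedFunctor A (leftPart C) => H.obj a) hF)
      (congrArg (fun H : GradedFunctor A (leftPart C) => H.obj a) hG) (φ.1 a) := by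
  subst hF hG
  rfl

/-- The action on a representable module is composition in `B`, which is precomposition once read in
the underlying graded category. -/
theorem toGradedFunctor_representable (A : B) :
    toGradedFunctor (representable (M := Hat V) A) =
      (yonedaEmbedding (ofEnriched (V := V) B)).obj A := by
  refine GradedFunctor.ext_castHom (fun _ => rfl) fun {X A' A''} f => left_ext fun Z p => ?_
  exact (leftApply_actLeft (representable (M := Hat V) A) f p).trans
    (leftApply_homPre (ofEnriched (V := V) B) f A p).symm

/-- `streetMap` is the transpose of composition, so evaluating it gives composition back; this is
`streetMap_fac` applied to `dayMul p f`. -/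
theorem evalRight_streetMap {X : Vᴹᵒᵖ} {A A' : B} (f : (A ⟶[Hat V] A').functor.obj (op X.unmop))
    (a : B) :
    evalRight (F := representable (M := Hat V) A) (G := representable (M := Hat V) A')
      (Hat.app (streetMap dayRightLifting A A') f) a =
        homPost (ofEnriched (V := V) B) a (X' := X) (B := A) (B' := A') f := by
  refine right_ext fun Z p => ?_
  refine (rightApply_evalRight (F := representable (M := Hat V) A)
    (G := representable (M := Hat V) A') (Hat.app (streetMap dayRightLifting A A') f) a p).trans ?_
  refine Eq.trans ?_ (rightApply_homPost (ofEnriched (V := V) B) a (B := A) (B' := A') f p).symm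
  have h := congrArg (fun t => Hat.app t (dayMul p f))
    (streetMap_fac (M := Hat V) dayRightLifting a A A')
  exact (congrArg (Hat.app _) (app_whiskerLeft _ _ p f)).symm.trans h

theorem comparison_comp_streetYoneda :
    (comparison (V := V) B).comp (ofEnrichedFunctor (streetYoneda dayRightLifting)) =
      yonedaEmbedding (ofEnriched (V := V) B) :=
  GradedFunctor.ext_castHom (toGradedFunctor_representable (V := V) (B := B)) fun f =>
    Subtype.ext (funext fun a =>
      (functorCat_castHom_val _ _ _ a).trans (evalRight_streetMap (V := V) (B := B) f a))

end ComparisonIso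

/-! ### The graded Yoneda lemma. -/

section Yoneda

variable {V : Type u} [Category.{u} V] [MonoidalCategory V] {E : RightGradedCat.{u, u} V}
  {F : GradedFunctor (formalOp E) (leftPart (hatBigraded V))}

theorem leftApply_map_res_left {X' : V} {a b : E.Obj} (x : (F.obj b).functor.obj (op X'))
    {Y Y' : V} (c : Y' ⟶ Y) (f : (homPresheaf E a b).functor.obj (op Y)) :
    leftApply (F.map (X := Y') (A := b) (B := a) ((homPresheaf E a b).res c f)) x =
      Hat.res (F.obj a) (c ▷ X') (leftApply (F.map (X := Y) (A := b) (B := a) f) x) :=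
  (congrArg (fun t => leftApply t x) (F.map_reindex (A := b) (B := a) c f)).trans
    (leftApply_reindex c _ x)

/-- The graded morphism `E(-, b) ⟶ F`, `f ↦ (Ff)(x)`, determined by an element `x` of `F b`. -/
noncomputable def yonedaExtend {X' : Vᴹᵒᵖ} {b : E.Obj} (x : (F.obj b).functor.obj (op X'.unmop)) :
    (functorCat (formalOp E) (hatBigraded V)).Hom X' ((yonedaEmbedding E).obj b) F :=
  ⟨fun a => ofRight (P := homPresheaf E a b) (Q := F.obj a)
      (fun Y f => leftApply (F.map (X := Y) (A := b) (B := a) f) x)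
      (leftApply_map_res_left (F := F) x),
    fun {Y a a'} f => (isBigradedSquare_hat_iff _ _ _ _).2 fun Z h => by
      refine (congrArg (leftApply (F.map f)) (rightApply_ofRight (P := homPresheaf E a b)
        (Q := F.obj a) _ _ h)).trans ?_
      refine Eq.trans ?_ (congrArg (Hat.res _ _) ((rightApply_ofRight (P := homPresheaf E a' b)
        (Q := F.obj a') _ _ _).trans (congrArg (fun t => leftApply (F.map (A := b) (B := a') t) x)
          (leftApply_homPre E f b h))).symm)
      -- The square is functoriality of `F`: precomposing `h` with `f` is composition in the formal
      -- opposite, so its image acts on `x` as `Ff` after `Fh`. The associator from this composite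
      -- cancels the one in the square condition.
      refine Eq.trans ?_ (congrArg (Hat.res _ _) ((congrArg (fun t => leftApply t x)
        (F.map_comp (A := b) (B := a) (E := a') f h)).trans (leftApply_comp _ _ x)).symm)
      refine Eq.trans ?_ (Hat.res_res _ _ _ _).symm
      exact ((Hat.res_congr _ (Iso.inv_hom_id _) _).trans (Hat.res_id _ _)).symm⟩

theorem rightApply_yonedaExtend {X' : Vᴹᵒᵖ} {b : E.Obj}
    (x : (F.obj b).functor.obj (op X'.unmop)) (a : E.Obj) {Y : V}
    (f : (homPresheaf E a b).functor.obj (op Y)) :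
    rightApply ((yonedaExtend (F := F) x).1 a) f =
      leftApply (F.map (X := Y) (A := b) (B := a) f) x :=
  rightApply_ofRight (P := homPresheaf E a b) (Q := F.obj a) _
    (leftApply_map_res_left (F := F) x) f

theorem functorCat_yoneda_ext {X' : Vᴹᵒᵖ} {b : E.Obj}
    {φ ψ : (functorCat (formalOp E) (hatBigraded V)).Hom X' ((yonedaEmbedding E).obj b) F}
    (h : ∀ (a : E.Obj) (Y : V) (f : (homPresheaf E a b).functor.obj (op Y)),
      rightApply (φ.1 a) f = rightApply (ψ.1 a) f) : φ = ψ :=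
  Subtype.ext (funext fun a => right_ext fun Y f => h a Y f)

/-- The element of `F b` obtained by evaluating a graded morphism `E(-, b) ⟶ F` at the
identity. -/
def yonedaEval {X' : Vᴹᵒᵖ} {b : E.Obj}
    (φ : (functorCat (formalOp E) (hatBigraded V)).Hom X' ((yonedaEmbedding E).obj b) F) :
    (F.obj b).functor.obj (op X'.unmop) :=
  Hat.res _ (λ_ X'.unmop).inv (rightApply (P := homPresheaf E b b) (Z := 𝟙_ V) (φ.1 b) (E.id b))

/-- `F` preserves identities, and the left unitor that this introduces is undone by the one in
`yonedaEval`. -/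
theorem yonedaEval_yonedaExtend {X' : Vᴹᵒᵖ} {b : E.Obj}
    (x : (F.obj b).functor.obj (op X'.unmop)) : yonedaEval (yonedaExtend (F := F) x) = x := by
  refine (congrArg (Hat.res _ _) ((rightApply_yonedaExtend x b (E.id b)).trans
    ((congrArg (fun t => leftApply t x) (F.map_id b)).trans (leftApply_id _ x)))).trans ?_
  refine (Hat.res_res _ _ _ _).trans ?_
  exact (Hat.res_congr _ (Iso.inv_hom_id _) _).trans (Hat.res_id _ _)

theorem yonedaExtend_yonedaEval {X' : Vᴹᵒᵖ} {b : E.Obj}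
    (φ : (functorCat (formalOp E) (hatBigraded V)).Hom X' ((yonedaEmbedding E).obj b) F) :
    yonedaExtend (yonedaEval φ) = φ := by
  refine functorCat_yoneda_ext fun a Y f => (rightApply_yonedaExtend _ a f).trans ?_
  -- The heart of the Yoneda argument: the square of `φ` at `f`, evaluated at the identity of `b`,
  -- expresses the value of `φ` at `f` through its value at the identity.
  have h := (isBigradedSquare_hat_iff _ _ _ _).1 (φ.2 (X := Y) (a := b) (b := a) f) (𝟙_ V) (E.id b)
  have h₁ : leftApply (((yonedaEmbedding E).obj b).map (X := Y) (A := b) (B := a) f) (E.id b) =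
      (homPresheaf E a b).res (ρ_ Y).hom f :=
    (leftApply_homPre E f b (E.id b)).trans (E.id_comp f)
  refine (leftApply_res _ _ _).trans ((congrArg (Hat.res _ _) (h.trans (congrArg (Hat.res _ _)
    ((congrArg (rightApply (φ.1 a)) h₁).trans (rightApply_res (φ.1 a) _ f))))).trans ?_)
  refine (congrArg (Hat.res _ _) (Hat.res_res _ _ _ _)).trans ((Hat.res_res _ _ _ _).trans
    ((Hat.res_congr _ ?_ _).trans (Hat.res_id _ _)))
  -- The remaining coherence identity is the triangle axiom: the unitor from `yonedaEval` against
  -- the one from composing `f` with the identity.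
  simp

theorem yonedaExtend_bijective {X' : Vᴹᵒᵖ} {b : E.Obj} :
    Function.Bijective (yonedaExtend (F := F) (X' := X') (b := b)) :=
  Function.bijective_iff_has_inverse.2 ⟨yonedaEval, yonedaEval_yonedaExtend,
    yonedaExtend_yonedaEval⟩

/-- For representable `F` the action of `f` on the element `g` is `g ∘ f`, so extending `g` gives
postcomposition with `g`. Full faithfulness thus becomes a special case of `yonedaExtend_bijective`.
-/
theorem yonedaEmbedding_map_eq {X' : Vᴹᵒᵖ} {b b' : E.Obj} (g : E.Hom X' b b') :
    (yonedaEmbedding E).map g = yonedaExtend (F := (yonedaEmbedding E).obj b') g := by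
  refine functorCat_yoneda_ext fun a Y f => ?_
  exact (rightApply_homPost E a g f).trans ((leftApply_homPre E f b' g).symm.trans
    (rightApply_yonedaExtend (F := (yonedaEmbedding E).obj b') g a f).symm)

theorem yonedaEmbedding_fullyFaithful (E : RightGradedCat.{u, u} V) :
    (yonedaEmbedding E).FullyFaithful := by
  intro X' b b'
  rw [show ((yonedaEmbedding E).map : E.Hom X' b b' → _) =
    yonedaExtend (F := (yonedaEmbedding E).obj b') from funext yonedaEmbedding_map_eq]
  exact yonedaExtend_bijective

/-- Naturality in the grade: this makes the maps `x ↦ yonedaExtend x` a morphism of presheaves, so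
that they define a graded morphism of grade `(I, I)`. -/
theorem yonedaExtend_res {X X' : V} (c : X' ⟶ X) {b : E.Obj}
    (x : (F.obj b).functor.obj (op X)) :
    yonedaExtend (X' := .mop X') (Hat.res (F.obj b) c x) =
      (functorCat (formalOp E) (hatBigraded V)).reindex c.mop
        (yonedaExtend (X' := .mop X) x) := by
  refine functorCat_yoneda_ext fun a Y f => (rightApply_yonedaExtend _ a f).trans ?_
  refine (leftApply_res _ c x).trans (Eq.trans (congrArg (Hat.res _ _)
    (rightApply_yonedaExtend (X' := .mop X) x a f).symm) ?_)
  exact (rightApply_reindex c.mop _ f).symm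

/-- Naturality in the variable `b`. Both sides send `h` to the action of `F (f ∘ h)` on `x`, by
functoriality of `F`. -/
theorem yonedaExtend_map {X : V} {X' : Vᴹᵒᵖ} {a b : E.Obj} (f : E.Hom (.mop X) a b)
    (x : (F.obj b).functor.obj (op X'.unmop)) :
    yonedaExtend (X' := X' ⊗ .mop X) (leftApply (F.map (X := X) (A := b) (B := a) f) x) =
      (functorCat (formalOp E) (hatBigraded V)).comp (yonedaExtend x)
        ((yonedaEmbedding E).map f) := by
  refine functorCat_yoneda_ext fun d Y h =>
    (rightApply_yonedaExtend (X' := X' ⊗ .mop X) _ d h).trans ?_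
  refine Eq.trans ?_ (rightApply_comp _ _ h).symm
  refine Eq.trans ?_ (congrArg (Hat.res _ _) ((congrArg (rightApply ((yonedaExtend x).1 d))
    (rightApply_homPost E d f h)).trans (rightApply_yonedaExtend x d _)).symm)
  refine Eq.trans ?_ (congrArg (Hat.res _ _) ((congrArg (fun t => leftApply t x)
    (F.map_comp (A := b) (B := a) (E := d) h f)).trans (leftApply_comp _ _ x)).symm)
  refine Eq.trans ?_ (Hat.res_res _ _ _ _).symm
  exact ((Hat.res_congr _ (Iso.inv_hom_id _) _).trans (Hat.res_id _ _)).symm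

/-- Naturality in the variable `F`. On `f` it is precisely the bigraded square of `g` at `f`,
evaluated at `x`. -/
theorem yonedaExtend_comp {F' : GradedFunctor (formalOp E) (leftPart (hatBigraded V))}
    {X' Y' : Vᴹᵒᵖ} {b : E.Obj} (g : (functorCat (formalOp E) (hatBigraded V)).Hom Y' F F')
    (x : (F.obj b).functor.obj (op X'.unmop)) :
    yonedaExtend (X' := Y' ⊗ X') (rightApply (g.1 b) x) =
      (functorCat (formalOp E) (hatBigraded V)).comp g (yonedaExtend x) := by
  refine functorCat_yoneda_ext fun a Y f =>
    (rightApply_yonedaExtend (X' := Y' ⊗ X') _ a f).trans ?_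
  refine Eq.trans ?_ (rightApply_comp _ _ f).symm
  refine Eq.trans ?_ (congrArg (fun t => Hat.res _ _ (rightApply (g.1 a) t))
    (rightApply_yonedaExtend x a f).symm)
  exact (isBigradedSquare_hat_iff _ _ _ _).1 (g.2 (X := Y) (a := b) (b := a) f) _ x

variable (E) in
/-- The transformation `Ev ⟶ [E°, V̂](y -, ?)` given by the maps `x ↦ (f ↦ (Ff)(x))`. -/
noncomputable def yonedaInverse :
    (evaluation (formalOp E) (hatBigraded V)).Transformation (yonedaHom E) where
  app b F := ofUnit (P := F.obj b)
    (Q := homPresheaf (functorCat (formalOp E) (hatBigraded V)) ((yonedaEmbedding E).obj b) F)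
    (fun Z x => yonedaExtend (F := F) (X' := .mop Z) x) (fun c x => yonedaExtend_res c x)
  natural_left F X a a' f := (naturalAt_left_iff f _ _).2 fun Z x => by
    refine (unitApply_ofUnit _ _ _).trans (Eq.trans ?_
      (congrArg (leftApply _) (unitApply_ofUnit _ _ x)).symm)
    exact (yonedaExtend_map f x).trans (leftApply_homPre _ _ F _).symm
  natural_right a X' F F' g := (naturalAt_right_iff g _ _).2 fun Z x => by
    refine (unitApply_ofUnit _ _ _).trans (Eq.trans ?_
      (congrArg (rightApply _) (unitApply_ofUnit _ _ x)).symm)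
    exact (yonedaExtend_comp g x).trans (rightApply_homPost _ _ g _).symm

theorem unitApply_yonedaInverse {b : E.Obj} {Z : V} (x : (F.obj b).functor.obj (op Z)) :
    unitApply ((yonedaInverse E).app b F) x = yonedaExtend (X' := .mop Z) x :=
  unitApply_ofUnit (P := F.obj b)
    (Q := homPresheaf (functorCat (formalOp E) (hatBigraded V)) ((yonedaEmbedding E).obj b) F)
    (fun Z x => yonedaExtend (F := F) (X' := .mop Z) x) (fun c x => yonedaExtend_res c x) x

end Yoneda

/-! ### Inverting transformations of graded bifunctors componentwise. -/

section Inverses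

variable {V : Type u} [Category.{u} V] [MonoidalCategory V] {A : GradedCat.{u, w₁} V}
  {B : RightGradedCat.{u, w₂} V} {F G : GradedBifunctor A B (hatBigraded V)}

/-- A transformation of graded bifunctors into `V̂` whose components are bijective has an inverse. -/
theorem GradedBifunctor.Transformation.exists_isInversePair (η : F.Transformation G)
    (hη : ∀ (a : A.Obj) (b : B.Obj) (Z : V), Function.Bijective
      (fun x : (F.obj a b).functor.obj (op Z) => unitApply (η.app a b) x)) :
    ∃ θ : G.Transformation F, θ.IsInversePair η := by
  choose m hl hr using fun a b Z => Function.bijective_iff_has_inverse.1 (hη a b Z)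
  let θ (a : A.Obj) (b : B.Obj) :
      (hatBigraded V).Hom (𝟙_ (V × Vᴹᵒᵖ)) (G.obj a b) (F.obj a b) :=
    -- The pointwise inverses are natural in `Z` because both sides agree after applying the
    -- injective map `unitApply (η.app a b)`.
    ofUnit (P := G.obj a b) (Q := F.obj a b) (m a b) (fun {Z Z'} c p =>
      (hη a b Z').1 ((hr a b Z' _).trans ((congrArg _ (hr a b Z p).symm).trans
        (unitApply_res (η.app a b) c _).symm)))
  have hθ : ∀ (a : A.Obj) (b : B.Obj) (Z : V) (p : (G.obj a b).functor.obj (op Z)),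
      unitApply (θ a b) p = m a b Z p := fun a b Z p => unitApply_ofUnit _ _ p
  have hr' : ∀ (a : A.Obj) (b : B.Obj) (Z : V) (p : (G.obj a b).functor.obj (op Z)),
      unitApply (η.app a b) (unitApply (θ a b) p) = p :=
    fun a b Z p => (congrArg _ (hθ a b Z p)).trans (hr a b Z p)
  have hl' : ∀ (a : A.Obj) (b : B.Obj) (Z : V) (p : (F.obj a b).functor.obj (op Z)),
      unitApply (θ a b) (unitApply (η.app a b) p) = p :=
    fun a b Z p => (hθ a b Z _).trans (hl a b Z p)
  refine ⟨{ app := θ, natural_left := ?_, natural_right := ?_ }, fun a b => ⟨?_, ?_⟩⟩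
  · intro b X a a' f
    -- As for naturality in `Z`, injectivity of the component of `η` at the target reduces graded
    -- naturality of the inverse to that of `η`.
    refine (naturalAt_left_iff f _ _).2 fun Z p => (hη a' b _).1 ?_
    refine (hr' a' b _ _).trans ?_
    refine Eq.trans ?_ ((naturalAt_left_iff f _ _).1 (η.natural_left b f) Z _).symm
    exact congrArg _ (hr' a b Z p).symm
  · intro a X' b b' g
    refine (naturalAt_right_iff g _ _).2 fun Z p => (hη a b' _).1 ?_
    refine (hr' a b' _ _).trans ?_
    refine Eq.trans ?_ ((naturalAt_right_iff g _ _).1 (η.natural_right a g) Z _).symm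
    exact congrArg _ (hr' a b Z p).symm
  · exact unit_ext fun Z p => (unitApply_comp₀ _ _ p).trans ((hr' a b Z p).trans
      (unitApply_id _ p).symm)
  · exact unit_ext fun Z p => (unitApply_comp₀ _ _ p).trans ((hl' a b Z p).trans
      (unitApply_id _ p).symm)

end Inverses

end VGraded

/-! ### The main theorem. -/

theorem mainTheorem5 (V : Type u) [Category.{u} V] [MonoidalCategory V]
    (B : Type u) [EnrichedCategory (Hat V) B] :
    (comparison (V := V) B).IsIso ∧
    (comparison (V := V) B).comp (ofEnrichedFunctor (streetYoneda dayRightLifting)) =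
      yonedaEmbedding (ofEnriched (V := V) B) ∧
    (yonedaEmbedding (ofEnriched (V := V) B)).FullyFaithful ∧
    ∃ (θ : (yonedaHom (ofEnriched (V := V) B)).Transformation
          (evaluation (formalOp (ofEnriched (V := V) B)) (hatBigraded V)))
      (η : (evaluation (formalOp (ofEnriched (V := V) B)) (hatBigraded V)).Transformation
          (yonedaHom (ofEnriched (V := V) B))),
      θ.IsInversePair η ∧
      ∀ (b : B) (F : GradedFunctor (formalOp (ofEnriched (V := V) B)) (leftPart (hatBigraded V)))
        (Z : V) (x : (F.obj b).functor.obj (op Z)) (a : B) (Y : V)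
        (f : (a ⟶[Hat V] b).functor.obj (op Y)),
        rightApply ((unitApply (η.app b F) x).1 a) f = leftApply (F.map f) x := by
  -- The Yoneda isomorphism is constructed from its prescribed inverse: the maps `x ↦ (f ↦ (Ff)(x))`
  -- are shown to be natural and bijective, and `θ` is then obtained by inverting them.
  obtain ⟨θ, h⟩ := (yonedaInverse (ofEnriched (V := V) B)).exists_isInversePair
    fun b F Z => by
      rw [show (fun x => unitApply ((yonedaInverse (ofEnriched (V := V) B)).app b F) x) =
        yonedaExtend (F := F) (X' := .mop Z) (b := b) from
          funext fun x => unitApply_yonedaInverse (F := F) x]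
      exact yonedaExtend_bijective
  refine ⟨comparison_isIso, comparison_comp_streetYoneda, yonedaEmbedding_fullyFaithful _,
    θ, yonedaInverse _, h, fun b F Z x a Y f => ?_⟩
  exact (congrArg (fun t => rightApply (t.1 a) f) (unitApply_yonedaInverse (F := F) x)).trans
    (rightApply_yonedaExtend (E := ofEnriched (V := V) B) (F := F) (X' := .mop Z) x a f)
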